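/- **Setting.** Let $d\to\infty$ and let $m,k,n,p,r$ be positive integers depending on $d$. For random matrices $A,\overline A\in\mathbb R^{k\times n}$ and $\overline W\in\mathbb R^{m\times k}$ put $$\mathcal L(W)=\tfrac1{2n}\|WA-\overline W\,\overline A\|_F^2\quad(W\in\mathbb R^{m\times k}),\qquad B=\tfrac1nAA^\top,\qquad \overline B=\tfrac1n\overline AA^\top ,$$ and let $W_0=0$, $W_{t+1}=W_t-\eta\nabla\mathcal L(W_t)$ with $\eta=\frac1{c\|B\|_{\rm op}}$ for a constant $c\ge1$. The nuclear rank of a matrix $G$ is $\mathrm{nr}(G)=\|G\|_*^2/\|G\|_F^2$. **Multi-spiked teacher–student model.** Fix constants $0<c_1\le c_2<\infty$ and $0<\ell\le u\le1$. The pair $(A,\overline A)$ satisfies the model if $B=H_1+\Gamma$ and $\overline B=H_2+\Sigma$, where * (spikes) $H_1=UQU^\top$ and $H_2=V\overline QU^\top$ for some $U,V\in\mathbb R^{k\times p}$ with orthonormal columns and some diagonal matrices $Q,\overline Q\in\mathbb R^{p\times p}$ with non-increasing diagonal entries, all lying in $[c_1d^\ell,c_2d^u]$, and the largest entry of $Q$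 is at least $c_1d^u$; * (bulk) $\Gamma$ is symmetric with $c_1I\preceq\Gamma\preceq c_2I$, and the $r$ largest singular values of $\Sigma$ lie in $[c_1,c_2]$. **Claim.** Suppose that $\overline W$ has i.i.d. entries $\mathcal N(0,1/d)$ and is independent of $(A,\overline A)$, and that $u-\ell<\frac12$, $p=o(d^{1-2(u-\ell)})$, $k/d\to\gamma\in(0,\infty)$, $m\asymp d$ and $r\asymp d$ as $d\to\infty$. Then there is a constant $C_1>0$ such that for every $C_3>0$ there is a constant $C_2>0$ for which the conditional probability given $(A,\overline A)$ of the event $$\mathrm{nr}(\nabla\mathcal L(W_t))\ \ge\ C_2\,d\qquad\text{for all integers }t\in[C_1d^{u-\ell}\log d,\;C_3d^u]$$ tends to one as $d\to\infty$, uniformly over almost all realizations of $(A,\overline A)$ that satisfy the model; that is, for every $\delta>0$ and all sufficiently large $d$, this conditional probability is at least $1-\delta$ for almost every realization of $(A,\overline A)$ that satisfies the model. -/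

import Mathlib

open MeasureTheory ProbabilityTheory Filter Asymptotics
open scoped Matrix NNReal Topology

noncomputable section

namespace MultiSpike

/-- Singular values of a real matrix in non-increasing order, repeated with multiplicity and
indexed from `0`: `singularValue M j` is the `(j+1)`-st largest one (zero past the rank). -/
def singularValue {a b : ℕ} (M : Matrix (Fin a) (Fin b) ℝ) (j : ℕ) : ℝ :=
  (Matrix.toEuclideanLin M).singularValues j

/-- Nuclear norm: the sum of the singular values. -/
def nuclearNorm {a b : ℕ} (M : Matrix (Fin a) (Fin b) ℝ) : ℝ :=
  ∑ j ∈ Finset.range b, singularValue M j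

/-- Frobenius norm. -/
def frobNorm {a b : ℕ} (M : Matrix (Fin a) (Fin b) ℝ) : ℝ :=
  √(∑ i, ∑ j, M i j ^ 2)

/-- Operator (spectral) norm of a square matrix. -/
def opNorm {a : ℕ} (M : Matrix (Fin a) (Fin a) ℝ) : ℝ :=
  ‖Matrix.toEuclideanCLM (n := Fin a) (𝕜 := ℝ) M‖

/-- Nuclear rank. -/
def nuclearRank {a b : ℕ} (M : Matrix (Fin a) (Fin b) ℝ) : ℝ :=
  nuclearNorm M ^ 2 / frobNorm M ^ 2

/-- Gradient of a function of a matrix (Frobenius inner product): the matrix of its partial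
derivatives with respect to the entries. -/
def matrixGradient {a b : ℕ} (f : Matrix (Fin a) (Fin b) ℝ → ℝ)
    (W : Matrix (Fin a) (Fin b) ℝ) : Matrix (Fin a) (Fin b) ℝ :=
  Matrix.of fun i j => lineDeriv ℝ f W (Matrix.single i j 1)

/-- The least squares loss `L(W) = (1/2n) ‖W A - Wbar Abar‖_F²`. -/
def loss {m k n : ℕ} (A Abar : Matrix (Fin k) (Fin n) ℝ) (Wbar W : Matrix (Fin m) (Fin k) ℝ) : ℝ :=
  1 / (2 * (n : ℝ)) * frobNorm (W * A - Wbar * Abar) ^ 2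

/-- Gradient descent on `loss A Abar Wbar` with step `η`, started at the zero matrix. -/
def gdIterate {m k n : ℕ} (A Abar : Matrix (Fin k) (Fin n) ℝ) (Wbar : Matrix (Fin m) (Fin k) ℝ)
    (η : ℝ) : ℕ → Matrix (Fin m) (Fin k) ℝ
  | 0 => 0
  | t + 1 => gdIterate A Abar Wbar η t -
      η • matrixGradient (loss A Abar Wbar) (gdIterate A Abar Wbar η t)

/-- The Gram matrix `B = (1/n) A Aᵀ`. -/
def gram {k n : ℕ} (A : Matrix (Fin k) (Fin n) ℝ) : Matrix (Fin k) (Fin k) ℝ :=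
  (1 / (n : ℝ)) • (A * Aᵀ)

/-- The cross-Gram matrix `(1/n) Abar Aᵀ`. -/
def crossGram {k n : ℕ} (A Abar : Matrix (Fin k) (Fin n) ℝ) : Matrix (Fin k) (Fin k) ℝ :=
  (1 / (n : ℝ)) • (Abar * Aᵀ)

/-- The multi-spiked teacher–student model:
`(1/n) A Aᵀ = H₁ + Γ` and `(1/n) Abar Aᵀ = H₂ + S`, where
* `H₁ = U diag(q) Uᵀ` and `H₂ = V diag(qbar) Uᵀ` are compact singular value decompositions of
  rank `p` with the same right factor `U`; all their singular values lie in
  `[c₁ d^ℓ, c₂ d^u]`, and the largest one of `H₁` has exact order `d^u`;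
* `c₁ I ⪯ Γ ⪯ c₂ I`, and the `r` largest singular values of `S` lie in `[c₁, c₂]`. -/
def MultiSpiked (d p r : ℕ) (c₁ c₂ ℓ u : ℝ) {k n : ℕ} (A Abar : Matrix (Fin k) (Fin n) ℝ) : Prop :=
  ∃ (H₁ H₂ Γ S : Matrix (Fin k) (Fin k) ℝ) (U V : Matrix (Fin k) (Fin p) ℝ) (q qbar : Fin p → ℝ),
    gram A = H₁ + Γ ∧ crossGram A Abar = H₂ + S ∧
    Uᵀ * U = 1 ∧ Vᵀ * V = 1 ∧ Antitone q ∧ Antitone qbar ∧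
    H₁ = U * Matrix.diagonal q * Uᵀ ∧ H₂ = V * Matrix.diagonal qbar * Uᵀ ∧
    (∀ i, q i ∈ Set.Icc (c₁ * (d : ℝ) ^ ℓ) (c₂ * (d : ℝ) ^ u)) ∧
    (∀ i, qbar i ∈ Set.Icc (c₁ * (d : ℝ) ^ ℓ) (c₂ * (d : ℝ) ^ u)) ∧
    (∃ i, c₁ * (d : ℝ) ^ u ≤ q i) ∧
    (Γ - c₁ • (1 : Matrix (Fin k) (Fin k) ℝ)).PosSemidef ∧
    (c₂ • (1 : Matrix (Fin k) (Fin k) ℝ) - Γ).PosSemidef ∧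
    ∀ j < r, singularValue S j ∈ Set.Icc c₁ c₂

/-- The σ-algebra generated by a pair of random matrices (that is, by all their entries). -/
abbrev sigmaPair {Ω : Type*} {k n : ℕ} (A Abar : Ω → Matrix (Fin k) (Fin n) ℝ) : MeasurableSpace Ω :=
  MeasurableSpace.comap (fun ω => ((fun i j => A ω i j, fun i j => Abar ω i j) :
    (Fin k → Fin n → ℝ) × (Fin k → Fin n → ℝ))) inferInstance

/-- The event that `nr(∇L(W_t)) ≥ C₂ d` for every iteration `t` of gradient descent with step
`η = 1 / (c ‖B‖_op)` in the window `C₁ d^(u-ℓ) log d ≤ t ≤ C₃ d^u`. -/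
def largeNuclearRankEvent {Ω : Type*} (d : ℕ) {m k n : ℕ} (c ℓ u C₁ C₂ C₃ : ℝ)
    (A Abar : Ω → Matrix (Fin k) (Fin n) ℝ) (Wbar : Ω → Matrix (Fin m) (Fin k) ℝ) : Set Ω :=
  {ω | ∀ t : ℕ, C₁ * (d : ℝ) ^ (u - ℓ) * Real.log d ≤ t → (t : ℝ) ≤ C₃ * (d : ℝ) ^ u →
    C₂ * d ≤ nuclearRank (matrixGradient (loss (A ω) (Abar ω) (Wbar ω))
      (gdIterate (A ω) (Abar ω) (Wbar ω) (1 / (c * opNorm (gram (A ω)))) t))}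

end MultiSpike

end

/-!
The gradient at `W_t` is `-Wbar * M` with `M = (H₂ + S) * (1 - η B) ^ t`. By the min-max principle
`B` has exactly `p` eigenvalues that are at least `c₁ d ^ ℓ`, and the others are at most `c₂`. The
lower end of the time window is chosen so that `(1 - η B) ^ t` has damped the large eigenvalues,
hence `‖B (1 - η B) ^ t‖ = O(1)`; since `U diag(q)` is at least of size `d ^ ℓ`, this gives
`H₂ * (1 - η B) ^ t = V * Y` with `‖Y‖ = O(d ^ (u - ℓ))`. At the upper end, `(1 - η B) ^ t` is still
bounded below on the eigenvectors for the small eigenvalues.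

Rescale the teacher to standard Gaussian entries, which leaves the nuclear rank unchanged. Its
product with `V` has squared Frobenius norm about `m p`, so the squared Frobenius norm of the
gradient is at most of order `d ^ (2 (u - ℓ)) m p + m k = O(d ^ 2)`. For the nuclear norm, let `D`
be the sum of the range of `U` and of the span of the eigenvectors for the large eigenvalues. On the
complement of `D`, a bounded right factor turns `Wbar * M` into `Wbar * S`. Each of the first `N`
rows of `Wbar * S` is a Gaussian vector of squared norm of order `d`, most of which survives the
projection off the at most `2 p + N` dimensions spanned by `D` and the earlier rows. By
Chebyshev's and Markov's inequalities at least half of these rows are therefore at distance of order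
`√d` from that span, and duality with the partial isometry obtained from them by the Gram-Schmidt
process bounds the nuclear norm below by a multiple of `d ^ (3 / 2)`.
-/

namespace MultiSpike

open scoped Matrix.Norms.L2Operator
open Matrix (toEuclideanLin vecMulVec)
open Module (finrank)

section OrthogonalImages

variable {E F : Type*} [NormedAddCommGroup E] [InnerProductSpace ℝ E] [NormedAddCommGroup F]
  [InnerProductSpace ℝ F]

theorem exists_orthonormalBasis_norm_apply_eq_singularValues [FiniteDimensional ℝ E]
    [FiniteDimensional ℝ F] (T : E →ₗ[ℝ] F) {n : ℕ} (hn : finrank ℝ E = n) :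
    ∃ v : OrthonormalBasis (Fin n) ℝ E, (∀ j, ‖T (v j)‖ = T.singularValues j) ∧
      Pairwise fun i j => inner ℝ (T (v i)) (T (v j)) = 0 := by
  have hT := T.isSymmetric_adjoint_comp_self
  have inner_apply (i j) : inner ℝ (T (hT.eigenvectorBasis hn i)) (T (hT.eigenvectorBasis hn j)) =
      hT.eigenvalues hn j * if i = j then 1 else 0 := by
    rw [← LinearMap.adjoint_inner_right, ← LinearMap.comp_apply,
      LinearMap.IsSymmetric.apply_eigenvectorBasis, inner_smul_right,
      orthonormal_iff_ite.1 (hT.eigenvectorBasis hn).orthonormal, RCLike.ofReal_real_eq_id, id]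
  refine ⟨hT.eigenvectorBasis hn, fun j => ?_, fun i j hij => ?_⟩
  · have norm_sq := inner_apply j j
    rw [if_pos rfl, mul_one, real_inner_self_eq_norm_sq] at norm_sq
    rw [T.singularValues_fin hn, ← norm_sq, Real.sqrt_sq (norm_nonneg _)]
  · exact (inner_apply i j).trans (by rw [if_neg hij, mul_zero])

theorem norm_sq_apply_eq_sum {ι : Type*} [Fintype ι] (T : E →ₗ[ℝ] F) (v : OrthonormalBasis ι ℝ E)
    (horth : Pairwise fun i j => inner ℝ (T (v i)) (T (v j)) = 0) (x : E) :
    ‖T x‖ ^ 2 = ∑ j, inner ℝ (v j) x ^ 2 * ‖T (v j)‖ ^ 2 := by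
  conv_lhs => rw [← v.sum_repr' x]
  simp only [map_sum, map_smul, ← real_inner_self_eq_norm_sq, sum_inner, inner_sum,
    real_inner_smul_left, real_inner_smul_right]
  refine Finset.sum_congr rfl fun j _ => ?_
  rw [Finset.sum_eq_single j (fun i _ hij => by rw [horth hij, mul_zero, mul_zero]) (by simp)]
  ring

theorem sum_sq_norm_apply_eq_sum_sq_norm_adjoint [FiniteDimensional ℝ E] [FiniteDimensional ℝ F]
    {ι κ : Type*} [Fintype ι] [Fintype κ] (T : E →ₗ[ℝ] F) (v : OrthonormalBasis ι ℝ E)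
    (w : OrthonormalBasis κ ℝ F) :
    ∑ i, ‖T (v i)‖ ^ 2 = ∑ j, ‖LinearMap.adjoint T (w j)‖ ^ 2 := by
  simp_rw [← w.sum_sq_inner_right, ← v.sum_sq_inner_right, LinearMap.adjoint_inner_right]
  rw [Finset.sum_comm]
  simp_rw [real_inner_comm]

theorem sum_sq_norm_apply_eq [FiniteDimensional ℝ E] [FiniteDimensional ℝ F] {ι κ : Type*}
    [Fintype ι] [Fintype κ] (T : E →ₗ[ℝ] F) (v : OrthonormalBasis ι ℝ E)
    (w : OrthonormalBasis κ ℝ E) : ∑ i, ‖T (v i)‖ ^ 2 = ∑ j, ‖T (w j)‖ ^ 2 := by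
  simp_rw [sum_sq_norm_apply_eq_sum_sq_norm_adjoint T _ (stdOrthonormalBasis ℝ F)]

end OrthogonalImages

section SingularValues

variable {a b c : ℕ}

theorem toEuclideanLin_apply_eq_sum (M : Matrix (Fin a) (Fin b) ℝ)
    (x : EuclideanSpace ℝ (Fin b)) (i : Fin a) : toEuclideanLin M x i = ∑ j, M i j * x j := by
  simp [Matrix.toLpLin_apply, Matrix.mulVec, dotProduct]

theorem toEuclideanLin_mul_apply (M : Matrix (Fin a) (Fin b) ℝ) (N : Matrix (Fin b) (Fin c) ℝ)
    (x : EuclideanSpace ℝ (Fin c)) :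
    toEuclideanLin (M * N) x = toEuclideanLin M (toEuclideanLin N x) := by
  simp [Matrix.toLpLin_apply]

theorem toEuclideanLin_transpose (M : Matrix (Fin a) (Fin b) ℝ) :
    toEuclideanLin Mᵀ = LinearMap.adjoint (toEuclideanLin M) := by
  rw [← Matrix.toEuclideanLin_conjTranspose_eq_adjoint,
    Matrix.conjTranspose_eq_transpose_of_trivial]

theorem toEuclideanLin_sum_vecMulVec {ι : Type*} (J : Finset ι)
    (v : ι → EuclideanSpace ℝ (Fin a)) (w : ι → EuclideanSpace ℝ (Fin b))
    (x : EuclideanSpace ℝ (Fin b)) :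
    toEuclideanLin (∑ j ∈ J, vecMulVec (v j) (w j)) x = ∑ j ∈ J, inner ℝ (w j) x • v j := by
  ext i
  simp [Matrix.toLpLin_apply, Matrix.vecMulVec_mulVec, PiLp.inner_apply, dotProduct, mul_comm]

theorem trace_mul_vecMulVec (M : Matrix (Fin a) (Fin b) ℝ) (x : EuclideanSpace ℝ (Fin b))
    (y : EuclideanSpace ℝ (Fin a)) :
    (M * vecMulVec x y).trace = inner ℝ y (toEuclideanLin M x) := by
  rw [Matrix.mul_vecMulVec, Matrix.trace_vecMulVec, EuclideanSpace.inner_eq_star_dotProduct]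
  simp [Matrix.toLpLin_apply, dotProduct_comm]

theorem norm_transpose (M : Matrix (Fin a) (Fin b) ℝ) : ‖Mᵀ‖ = ‖M‖ := by
  rw [← Matrix.conjTranspose_eq_transpose_of_trivial, Matrix.l2_opNorm_conjTranspose]

theorem norm_toEuclideanLin_apply_le (M : Matrix (Fin a) (Fin b) ℝ)
    (x : EuclideanSpace ℝ (Fin b)) : ‖toEuclideanLin M x‖ ≤ ‖M‖ * ‖x‖ :=
  Matrix.l2_opNorm_mulVec M x

theorem norm_le_of_toEuclideanLin (M : Matrix (Fin a) (Fin b) ℝ) {K : ℝ} (hK : 0 ≤ K)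
    (h : ∀ x, ‖toEuclideanLin M x‖ ≤ K * ‖x‖) : ‖M‖ ≤ K := by
  rw [Matrix.l2_opNorm_def]
  exact ContinuousLinearMap.opNorm_le_bound _ hK h

theorem norm_sum_vecMulVec_le_one {ι : Type*} {v : ι → EuclideanSpace ℝ (Fin a)}
    {w : ι → EuclideanSpace ℝ (Fin b)} (hv : Orthonormal ℝ v) (hw : Orthonormal ℝ w)
    (J : Finset ι) : ‖∑ j ∈ J, vecMulVec (v j) (w j)‖ ≤ 1 := by
  refine norm_le_of_toEuclideanLin _ zero_le_one fun x => ?_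
  rw [toEuclideanLin_sum_vecMulVec, one_mul]
  refine le_of_sq_le_sq ?_ (norm_nonneg x)
  rw [← real_inner_self_eq_norm_sq, hv.inner_sum]
  simpa [← pow_two] using hw.sum_inner_products_le x (s := J)

theorem exists_rightSingularBasis (M : Matrix (Fin a) (Fin b) ℝ) :
    ∃ v : OrthonormalBasis (Fin b) ℝ (EuclideanSpace ℝ (Fin b)),
      (∀ j, ‖toEuclideanLin M (v j)‖ = singularValue M j) ∧
      Pairwise fun i j => inner ℝ (toEuclideanLin M (v i)) (toEuclideanLin M (v j)) = 0 :=
  exists_orthonormalBasis_norm_apply_eq_singularValues _ finrank_euclideanSpace_fin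

theorem singularValue_nonneg (M : Matrix (Fin a) (Fin b) ℝ) (j : ℕ) : 0 ≤ singularValue M j :=
  LinearMap.singularValues_nonneg _ j

theorem singularValue_of_le (M : Matrix (Fin a) (Fin b) ℝ) {j : ℕ} (hj : b ≤ j) :
    singularValue M j = 0 :=
  LinearMap.singularValues_of_finrank_le _ (by rwa [finrank_euclideanSpace_fin])

theorem norm_le_singularValue_zero (M : Matrix (Fin a) (Fin b) ℝ) : ‖M‖ ≤ singularValue M 0 := by
  obtain ⟨v, hv, horth⟩ := exists_rightSingularBasis M
  refine norm_le_of_toEuclideanLin M (singularValue_nonneg _ _) fun x => ?_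
  refine le_of_sq_le_sq ?_ (mul_nonneg (singularValue_nonneg _ _) (norm_nonneg _))
  rw [norm_sq_apply_eq_sum _ v horth, mul_pow, ← v.sum_sq_inner_right x, mul_comm,
    Finset.sum_mul]
  simp_rw [hv]
  gcongr with j _
  · exact singularValue_nonneg _ _
  · exact LinearMap.singularValues_antitone _ (Nat.zero_le _)

end SingularValues

section NuclearNorm

variable {a b : ℕ}

theorem nuclearNorm_eq_sum_fin (M : Matrix (Fin a) (Fin b) ℝ) :
    nuclearNorm M = ∑ j : Fin b, singularValue M j :=
  Finset.sum_range _

theorem nuclearNorm_nonneg (M : Matrix (Fin a) (Fin b) ℝ) : 0 ≤ nuclearNorm M :=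
  Finset.sum_nonneg fun _ _ => singularValue_nonneg _ _

theorem trace_mul_le_norm_mul_nuclearNorm (M : Matrix (Fin a) (Fin b) ℝ)
    (Y : Matrix (Fin b) (Fin a) ℝ) : (M * Y).trace ≤ ‖Y‖ * nuclearNorm M := by
  obtain ⟨v, hv, -⟩ := exists_rightSingularBasis M
  rw [Matrix.trace_mul_comm, ← Matrix.trace_toLin_eq _ (PiLp.basisFun 2 ℝ _),
    ← Matrix.toLpLin_eq_toLin, LinearMap.trace_eq_sum_inner _ v, nuclearNorm_eq_sum_fin,
    Finset.mul_sum]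
  refine Finset.sum_le_sum fun j _ => (real_inner_le_norm _ _).trans ?_
  rw [v.norm_eq_one, one_mul, ← hv]
  exact (congrArg norm (toEuclideanLin_mul_apply Y M (v j))).trans_le
    (norm_toEuclideanLin_apply_le _ _)

theorem exists_trace_mul_eq_nuclearNorm (M : Matrix (Fin a) (Fin b) ℝ) :
    ∃ Y : Matrix (Fin b) (Fin a) ℝ, ‖Y‖ ≤ 1 ∧ (M * Y).trace = nuclearNorm M := by
  obtain ⟨v, hv, horth⟩ := exists_rightSingularBasis M
  let w (j : {j : Fin b // singularValue M j ≠ 0}) : EuclideanSpace ℝ (Fin a) :=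
    (singularValue M j)⁻¹ • toEuclideanLin M (v j)
  have hw : Orthonormal ℝ w := by
    refine ⟨fun j => ?_, fun i j hij => ?_⟩
    · rw [norm_smul, hv, norm_inv, Real.norm_of_nonneg (singularValue_nonneg _ _),
        inv_mul_cancel₀ j.2]
    · have : inner ℝ (toEuclideanLin M (v i)) (toEuclideanLin M (v j)) = 0 :=
        horth (Subtype.coe_injective.ne hij)
      simp only [w, real_inner_smul_left, real_inner_smul_right, this, mul_zero]
  refine ⟨_, norm_sum_vecMulVec_le_one (v.orthonormal.comp _ Subtype.val_injective) hw .univ, ?_⟩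
  simp only [Matrix.mul_sum, Matrix.trace_sum, trace_mul_vecMulVec, Function.comp_apply, w,
    real_inner_smul_left, real_inner_self_eq_norm_sq, hv, nuclearNorm_eq_sum_fin]
  rw [← Finset.sum_filter_ne_zero (s := .univ (α := Fin b)),
    Finset.sum_subtype _ (p := fun j : Fin b => singularValue M j ≠ 0) (by simp)]
  exact Finset.sum_congr rfl fun j _ => by field_simp [j.2]

theorem nuclearNorm_smul_le (s : ℝ) (M : Matrix (Fin a) (Fin b) ℝ) :
    nuclearNorm (s • M) ≤ |s| * nuclearNorm M := by
  obtain ⟨Y, hY, trace_eq⟩ := exists_trace_mul_eq_nuclearNorm (s • M)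
  calc nuclearNorm (s • M) = (M * (s • Y)).trace := by
        rw [← trace_eq, Matrix.smul_mul, Matrix.mul_smul]
    _ ≤ ‖s • Y‖ * nuclearNorm M := trace_mul_le_norm_mul_nuclearNorm _ _
    _ ≤ |s| * nuclearNorm M := by
        rw [norm_smul, Real.norm_eq_abs]
        exact mul_le_mul_of_nonneg_right (mul_le_of_le_one_right (abs_nonneg s) hY)
          (nuclearNorm_nonneg M)

theorem nuclearNorm_smul (s : ℝ) (M : Matrix (Fin a) (Fin b) ℝ) :
    nuclearNorm (s • M) = |s| * nuclearNorm M := by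
  rcases eq_or_ne s 0 with rfl | hs
  · exact le_antisymm (nuclearNorm_smul_le 0 M) (by simpa using nuclearNorm_nonneg _)
  refine le_antisymm (nuclearNorm_smul_le s M) ?_
  have := nuclearNorm_smul_le s⁻¹ (s • M)
  rwa [inv_smul_smul₀ hs, abs_inv, ← div_eq_inv_mul, le_div_iff₀' (abs_pos.2 hs)] at this

theorem sum_inner_le_norm_mul_nuclearNorm {c : ℕ} {ι : Type*} (M : Matrix (Fin a) (Fin b) ℝ)
    (R : Matrix (Fin b) (Fin c) ℝ) {v : ι → EuclideanSpace ℝ (Fin c)}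
    {w : ι → EuclideanSpace ℝ (Fin a)} (hv : Orthonormal ℝ v) (hw : Orthonormal ℝ w)
    (J : Finset ι) :
    ∑ j ∈ J, inner ℝ (w j) (toEuclideanLin (M * R) (v j)) ≤ ‖R‖ * nuclearNorm M := by
  calc ∑ j ∈ J, inner ℝ (w j) (toEuclideanLin (M * R) (v j))
      = (M * (R * ∑ j ∈ J, vecMulVec (v j) (w j))).trace := by
        simp only [← Matrix.mul_assoc, Matrix.mul_sum, Matrix.trace_sum, trace_mul_vecMulVec]
    _ ≤ ‖R * ∑ j ∈ J, vecMulVec (v j) (w j)‖ * nuclearNorm M :=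
        trace_mul_le_norm_mul_nuclearNorm _ _
    _ ≤ ‖R‖ * 1 * nuclearNorm M := by
        gcongr
        · exact nuclearNorm_nonneg M
        · exact (Matrix.l2_opNorm_mul _ _).trans
            (mul_le_mul_of_nonneg_left (norm_sum_vecMulVec_le_one hv hw J) (norm_nonneg R))
    _ = ‖R‖ * nuclearNorm M := by rw [mul_one]

end NuclearNorm

section FrobeniusNorm

variable {a b c : ℕ}

theorem frobNorm_sq (M : Matrix (Fin a) (Fin b) ℝ) : frobNorm M ^ 2 = ∑ i, ∑ j, M i j ^ 2 :=
  Real.sq_sqrt (by positivity)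

theorem frobNorm_sq_eq_sum_norm_row (M : Matrix (Fin a) (Fin b) ℝ) :
    frobNorm M ^ 2 = ∑ i, ‖WithLp.toLp 2 (M i)‖ ^ 2 := by
  simp [frobNorm_sq, EuclideanSpace.real_norm_sq_eq]

theorem frobNorm_transpose (M : Matrix (Fin a) (Fin b) ℝ) : frobNorm Mᵀ = frobNorm M := by
  rw [frobNorm, frobNorm, Finset.sum_comm]
  rfl

theorem frobNorm_smul_sq (s : ℝ) (M : Matrix (Fin a) (Fin b) ℝ) :
    frobNorm (s • M) ^ 2 = s ^ 2 * frobNorm M ^ 2 := by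
  simp [frobNorm_sq, mul_pow, Finset.mul_sum]

theorem frobNorm_add_sq_le (M N : Matrix (Fin a) (Fin b) ℝ) :
    frobNorm (M + N) ^ 2 ≤ 2 * frobNorm M ^ 2 + 2 * frobNorm N ^ 2 := by
  simp only [frobNorm_sq, Finset.mul_sum, ← Finset.sum_add_distrib, Matrix.add_apply]
  gcongr with i _ j _
  nlinarith [sq_nonneg (M i j - N i j)]

theorem toLp_row_mul (M : Matrix (Fin a) (Fin b) ℝ) (N : Matrix (Fin b) (Fin c) ℝ) (i : Fin a) :
    WithLp.toLp 2 ((M * N) i) = toEuclideanLin Nᵀ (WithLp.toLp 2 (M i)) := by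
  ext j
  rw [toEuclideanLin_apply_eq_sum]
  simp [Matrix.mul_apply, mul_comm]

theorem frobNorm_mul_sq_le (M : Matrix (Fin a) (Fin b) ℝ) (X : Matrix (Fin b) (Fin c) ℝ) :
    frobNorm (M * X) ^ 2 ≤ ‖X‖ ^ 2 * frobNorm M ^ 2 := by
  simp only [frobNorm_sq_eq_sum_norm_row, toLp_row_mul, Finset.mul_sum, ← mul_pow]
  gcongr with i _
  exact norm_transpose X ▸ norm_toEuclideanLin_apply_le _ _

theorem frobNorm_sq_eq_sum_norm_basis {ι : Type*} [Fintype ι] (M : Matrix (Fin a) (Fin b) ℝ)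
    (v : OrthonormalBasis ι ℝ (EuclideanSpace ℝ (Fin b))) :
    frobNorm M ^ 2 = ∑ j, ‖toEuclideanLin M (v j)‖ ^ 2 := by
  rw [sum_sq_norm_apply_eq_sum_sq_norm_adjoint _ v (EuclideanSpace.basisFun (Fin a) ℝ),
    frobNorm_sq_eq_sum_norm_row]
  refine Finset.sum_congr rfl fun i _ => ?_
  congr 2
  ext j
  rw [← toEuclideanLin_transpose, toEuclideanLin_apply_eq_sum]
  simp

theorem frobNorm_sq_eq_sum_sq_singularValue (M : Matrix (Fin a) (Fin b) ℝ) :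
    frobNorm M ^ 2 = ∑ j : Fin b, singularValue M j ^ 2 := by
  obtain ⟨v, hv, -⟩ := exists_rightSingularBasis M
  simp_rw [frobNorm_sq_eq_sum_norm_basis M v, hv]

theorem mul_sq_le_frobNorm_sq (M : Matrix (Fin a) (Fin b) ℝ) {r : ℕ} {α : ℝ} (hα : 0 < α)
    (h : ∀ j < r, α ≤ singularValue M j) : r * α ^ 2 ≤ frobNorm M ^ 2 := by
  have hr : r ≤ b := by
    by_contra! hlt
    exact hα.not_ge (singularValue_of_le M le_rfl ▸ h b hlt)
  rw [frobNorm_sq_eq_sum_sq_singularValue, Fin.sum_univ_eq_sum_range fun j => singularValue M j ^ 2]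
  calc (r : ℝ) * α ^ 2 = ∑ j ∈ Finset.range r, α ^ 2 := by simp
    _ ≤ ∑ j ∈ Finset.range r, singularValue M j ^ 2 := by
        gcongr with j hj
        exact h j (Finset.mem_range.1 hj)
    _ ≤ _ := Finset.sum_le_sum_of_subset_of_nonneg (Finset.range_mono hr) fun _ _ _ => sq_nonneg _

theorem frobNorm_sq_of_transpose_mul_self_eq_one {V : Matrix (Fin a) (Fin b) ℝ} (hV : Vᵀ * V = 1) :
    frobNorm V ^ 2 = b := by
  have trace_eq : frobNorm V ^ 2 = (Vᵀ * V).trace := by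
    rw [frobNorm_sq, Finset.sum_comm]
    simp [Matrix.trace, Matrix.mul_apply, pow_two]
  rw [trace_eq, hV, Matrix.trace_one, Fintype.card_fin]

theorem nuclearRank_smul {s : ℝ} (hs : s ≠ 0) (M : Matrix (Fin a) (Fin b) ℝ) :
    nuclearRank (s • M) = nuclearRank M := by
  rw [nuclearRank, nuclearNorm_smul, frobNorm_smul_sq, mul_pow, sq_abs,
    mul_div_mul_left _ _ (pow_ne_zero 2 hs), nuclearRank]

theorem div_le_nuclearRank {G : Matrix (Fin a) (Fin b) ℝ} {x y : ℝ} (hx : 0 < x)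
    (hnuc : x ≤ nuclearNorm G) (hfrob : frobNorm G ^ 2 ≤ y) : x ^ 2 / y ≤ nuclearRank G := by
  have frob_pos : 0 < frobNorm G ^ 2 := by
    rw [frobNorm_sq_eq_sum_sq_singularValue]
    obtain ⟨j, -, hj⟩ : ∃ j ∈ Finset.univ, singularValue G (j : Fin b) ≠ 0 :=
      Finset.exists_ne_zero_of_sum_ne_zero
        (nuclearNorm_eq_sum_fin G ▸ (hx.trans_le hnuc).ne')
    exact Finset.sum_pos' (fun _ _ => sq_nonneg _) ⟨j, Finset.mem_univ j, by positivity⟩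
  rw [nuclearRank]
  gcongr

end FrobeniusNorm

section Gradient

variable {m k n : ℕ}

theorem frobNorm_add_smul_sq (X Y : Matrix (Fin m) (Fin k) ℝ) (s : ℝ) :
    frobNorm (X + s • Y) ^ 2 =
      frobNorm X ^ 2 + s * (2 * (X * Yᵀ).trace) + s ^ 2 * frobNorm Y ^ 2 := by
  simp only [frobNorm_sq, Matrix.trace, Matrix.diag_apply, Matrix.mul_apply, Matrix.add_apply,
    Matrix.smul_apply, Matrix.transpose_apply, smul_eq_mul, Finset.mul_sum,
    ← Finset.sum_add_distrib]
  exact Finset.sum_congr rfl fun i _ => Finset.sum_congr rfl fun j _ => by ring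

theorem matrixGradient_loss (A Abar : Matrix (Fin k) (Fin n) ℝ)
    (Wbar W : Matrix (Fin m) (Fin k) ℝ) :
    matrixGradient (loss A Abar Wbar) W = W * gram A - Wbar * crossGram A Abar := by
  ext i j
  set X := W * A - Wbar * Abar with hX
  set E : Matrix (Fin m) (Fin k) ℝ := Matrix.single i j 1
  have loss_line (s : ℝ) : loss A Abar Wbar (W + s • E) = 1 / (2 * (n : ℝ)) *
      (frobNorm X ^ 2 + s * (2 * (X * (E * A)ᵀ).trace) + s ^ 2 * frobNorm (E * A) ^ 2) := by
    rw [loss, Matrix.add_mul, Matrix.smul_mul, add_sub_right_comm, frobNorm_add_smul_sq]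
  have hasDerivAt_loss : HasDerivAt (fun s : ℝ => loss A Abar Wbar (W + s • E))
      (1 / (2 * (n : ℝ)) * (2 * (X * (E * A)ᵀ).trace)) 0 := by
    simp only [loss_line]
    refine HasDerivAt.const_mul _ ?_
    simpa using (((hasDerivAt_id' (0 : ℝ)).mul_const (2 * (X * (E * A)ᵀ).trace)).const_add
      (frobNorm X ^ 2)).fun_add (((hasDerivAt_id' (0 : ℝ)).fun_pow 2).mul_const
        (frobNorm (E * A) ^ 2))
  have trace_eq : (X * (E * A)ᵀ).trace = (X * Aᵀ) i j := by
    rw [Matrix.transpose_mul, ← Matrix.mul_assoc]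
    simp [E, Matrix.trace_mul_single]
  have grad_eq : W * gram A - Wbar * crossGram A Abar = (1 / (n : ℝ)) • (X * Aᵀ) := by
    simp only [hX, gram, crossGram, Matrix.mul_smul, Matrix.sub_mul, smul_sub, Matrix.mul_assoc]
  rw [matrixGradient, Matrix.of_apply, lineDeriv, hasDerivAt_loss.deriv, trace_eq, grad_eq,
    Matrix.smul_apply, smul_eq_mul]
  field_simp

theorem matrixGradient_gdIterate (A Abar : Matrix (Fin k) (Fin n) ℝ)
    (Wbar : Matrix (Fin m) (Fin k) ℝ) (η : ℝ) (t : ℕ) :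
    matrixGradient (loss A Abar Wbar) (gdIterate A Abar Wbar η t) =
      -(Wbar * (crossGram A Abar * (1 - η • gram A) ^ t)) := by
  induction t with
  | zero => simp [matrixGradient_loss, gdIterate]
  | succ t ih =>
    rw [gdIterate, ih, matrixGradient_loss, Matrix.sub_mul, sub_right_comm, ← matrixGradient_loss,
      ih, pow_succ]
    simp only [Matrix.mul_sub, Matrix.mul_one, Matrix.mul_smul, Matrix.smul_mul, Matrix.neg_mul,
      Matrix.mul_assoc, smul_neg]
    abel

end Gradient

section FunctionalCalculus

variable {k : ℕ} {B : Matrix (Fin k) (Fin k) ℝ}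

theorem cfc_eq_mul_diagonal_mul (hB : B.IsHermitian) (f : ℝ → ℝ) :
    cfc f B = hB.eigenvectorUnitary * Matrix.diagonal (fun i => f (hB.eigenvalues i)) *
      star (hB.eigenvectorUnitary : Matrix (Fin k) (Fin k) ℝ) := by
  rw [hB.cfc_eq, Matrix.IsHermitian.cfc, Unitary.conjStarAlgAut_apply]
  rfl

theorem toEuclideanLin_cfc_eigenvectorBasis (hB : B.IsHermitian) (f : ℝ → ℝ) (i : Fin k) :
    toEuclideanLin (cfc f B) (hB.eigenvectorBasis i) =
      f (hB.eigenvalues i) • hB.eigenvectorBasis i := by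
  rw [cfc_eq_mul_diagonal_mul hB, Matrix.toLpLin_apply, ← Matrix.mulVec_mulVec,
    ← Matrix.mulVec_mulVec, hB.star_eigenvectorUnitary_mulVec, Matrix.diagonal_mulVec_single,
    Matrix.mulVec_single, ← Matrix.mulVec_single_one, hB.eigenvectorUnitary_mulVec, mul_one,
    op_smul_eq_smul]
  rfl

theorem toEuclideanLin_cfc_apply (hB : B.IsHermitian) (f : ℝ → ℝ)
    (x : EuclideanSpace ℝ (Fin k)) :
    toEuclideanLin (cfc f B) x =
      ∑ i, (inner ℝ (hB.eigenvectorBasis i) x * f (hB.eigenvalues i)) • hB.eigenvectorBasis i := by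
  conv_lhs => rw [← hB.eigenvectorBasis.sum_repr' x]
  simp only [map_sum, map_smul, toEuclideanLin_cfc_eigenvectorBasis, smul_smul]

theorem norm_cfc_le_of_eigenvalues (hB : B.IsHermitian) {f : ℝ → ℝ} {K : ℝ} (hK : 0 ≤ K)
    (hf : ∀ i, |f (hB.eigenvalues i)| ≤ K) : ‖cfc f B‖ ≤ K := by
  rw [cfc_eq_mul_diagonal_mul hB, ← Unitary.coe_star, CStarRing.norm_mul_coe_unitary,
    CStarRing.norm_coe_unitary_mul, Matrix.l2_opNorm_diagonal]
  exact (pi_norm_le_iff_of_nonneg hK).2 hf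

theorem inner_toEuclideanLin_eq_sum_eigenvalues (hB : B.IsHermitian)
    (x : EuclideanSpace ℝ (Fin k)) :
    inner ℝ x (toEuclideanLin B x) =
      ∑ i, hB.eigenvalues i * inner ℝ (hB.eigenvectorBasis i) x ^ 2 := by
  nth_rw 1 [← cfc_id ℝ B]
  rw [toEuclideanLin_cfc_apply hB, inner_sum]
  refine Finset.sum_congr rfl fun i _ => ?_
  rw [real_inner_smul_right, real_inner_comm, id]
  ring

theorem toEuclideanLin_eigenvectorBasis (hB : B.IsHermitian) (i : Fin k) :
    toEuclideanLin B (hB.eigenvectorBasis i) = hB.eigenvalues i • hB.eigenvectorBasis i := by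
  simpa only [cfc_id ℝ B, id] using toEuclideanLin_cfc_eigenvectorBasis hB id i

theorem abs_eigenvalues_le_norm (hB : B.IsHermitian) (i : Fin k) : |hB.eigenvalues i| ≤ ‖B‖ := by
  simpa [toEuclideanLin_eigenvectorBasis, norm_smul] using
    norm_toEuclideanLin_apply_le B (hB.eigenvectorBasis i)

theorem one_sub_smul_pow_eq_cfc (hB : B.IsHermitian) (η : ℝ) (t : ℕ) :
    (1 - η • B) ^ t = cfc (fun x => (1 - η * x) ^ t) B := by
  have hB' : IsSelfAdjoint B := hB
  rw [cfc_pow .., cfc_sub .., cfc_const_mul .., cfc_const_one ℝ B, cfc_id' ℝ B]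

theorem inner_toEuclideanLin_nonneg (hB : B.PosSemidef) (x : EuclideanSpace ℝ (Fin k)) :
    0 ≤ inner ℝ x (toEuclideanLin B x) := by
  have := hB.dotProduct_mulVec_nonneg x.ofLp
  simpa [Matrix.toLpLin_apply, EuclideanSpace.inner_eq_star_dotProduct, dotProduct_comm] using this

theorem inner_toEuclideanLin_le {β : ℝ}
    (hB : (β • (1 : Matrix (Fin k) (Fin k) ℝ) - B).PosSemidef) (x : EuclideanSpace ℝ (Fin k)) :
    inner ℝ x (toEuclideanLin B x) ≤ β * ‖x‖ ^ 2 := by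
  have := inner_toEuclideanLin_nonneg hB x
  rw [map_sub, LinearMap.sub_apply, inner_sub_right, map_smul, LinearMap.smul_apply,
    Matrix.toLpLin_one, LinearMap.id_apply, real_inner_smul_right,
    real_inner_self_eq_norm_sq] at this
  exact sub_nonneg.1 this

theorem norm_le_of_posSemidef {β : ℝ} (hβ : 0 ≤ β) (hB : B.PosSemidef)
    (hB_le : (β • (1 : Matrix (Fin k) (Fin k) ℝ) - B).PosSemidef) : ‖B‖ ≤ β := by
  rw [← cfc_id ℝ B hB.isHermitian]
  refine norm_cfc_le_of_eigenvalues hB.isHermitian hβ fun i => ?_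
  have := inner_toEuclideanLin_le hB_le (hB.isHermitian.eigenvectorBasis i)
  rw [toEuclideanLin_eigenvectorBasis, real_inner_smul_right, real_inner_self_eq_norm_sq,
    OrthonormalBasis.norm_eq_one, one_pow, mul_one, mul_one] at this
  rwa [id, abs_of_nonneg (hB.eigenvalues_nonneg i)]

theorem finrank_le_card_le_eigenvalues {E ι : Type*} [NormedAddCommGroup E]
    [InnerProductSpace ℝ E] [Fintype ι] (e : OrthonormalBasis ι ℝ E) (ev : ι → ℝ) (α : ℝ)
    (S : Submodule ℝ E) (hS : ∀ x ∈ S, α * ‖x‖ ^ 2 ≤ ∑ i, ev i * inner ℝ (e i) x ^ 2) :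
    finrank ℝ S ≤ (Finset.univ.filter fun i => α ≤ ev i).card := by
  have : FiniteDimensional ℝ E := e.toBasis.finiteDimensional_of_finite
  by_contra! hlt
  let coords : S →ₗ[ℝ] ({i // α ≤ ev i} → ℝ) :=
    LinearMap.pi fun i => (innerₗ E (e i)).comp S.subtype
  have ker_ne_bot : LinearMap.ker coords ≠ ⊥ := LinearMap.ker_ne_bot_of_finrank_lt
    (by rwa [Module.finrank_fintype_fun_eq_card, Fintype.card_subtype])
  obtain ⟨x, hx, hx0⟩ := Submodule.exists_mem_ne_zero_of_ne_bot ker_ne_bot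
  have inner_eq_zero (i) (hi : α ≤ ev i) : inner ℝ (e i) (x : E) = 0 :=
    congrFun (LinearMap.mem_ker.1 hx) ⟨i, hi⟩
  obtain ⟨j, hj⟩ : ∃ j, inner ℝ (e j) (x : E) ≠ 0 := by
    by_contra! h
    exact hx0 (Subtype.ext (e.toBasis.ext_elem_iff.2 fun i => by
      simp [OrthonormalBasis.repr_apply_apply, h]))
  have ev_lt : ev j < α := not_le.1 fun h => hj (inner_eq_zero j h)
  refine (hS x x.2).not_gt ?_
  rw [← e.sum_sq_inner_right, Finset.mul_sum]
  refine Finset.sum_lt_sum (fun i _ => ?_) ⟨j, Finset.mem_univ j, by gcongr⟩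
  rcases le_or_gt α (ev i) with hi | hi
  · simp [inner_eq_zero i hi]
  · gcongr

end FunctionalCalculus

section Isometry

variable {a b : ℕ} {U : Matrix (Fin a) (Fin b) ℝ}

theorem toEuclideanLin_transpose_apply_apply (hU : Uᵀ * U = 1) (y : EuclideanSpace ℝ (Fin b)) :
    toEuclideanLin Uᵀ (toEuclideanLin U y) = y := by
  rw [← toEuclideanLin_mul_apply, hU, Matrix.toLpLin_one, LinearMap.id_apply]

theorem norm_toEuclideanLin_apply_eq (hU : Uᵀ * U = 1) (y : EuclideanSpace ℝ (Fin b)) :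
    ‖toEuclideanLin U y‖ = ‖y‖ := by
  rw [← sq_eq_sq₀ (norm_nonneg _) (norm_nonneg _), ← real_inner_self_eq_norm_sq,
    ← LinearMap.adjoint_inner_right, ← toEuclideanLin_transpose,
    toEuclideanLin_transpose_apply_apply hU, real_inner_self_eq_norm_sq]

theorem norm_le_one_of_transpose_mul_self_eq_one (hU : Uᵀ * U = 1) : ‖U‖ ≤ 1 :=
  norm_le_of_toEuclideanLin U zero_le_one fun x => by
    rw [norm_toEuclideanLin_apply_eq hU, one_mul]

theorem finrank_range_of_transpose_mul_self_eq_one (hU : Uᵀ * U = 1) :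
    finrank ℝ (LinearMap.range (toEuclideanLin U)) = b := by
  rw [LinearMap.finrank_range_of_inj
    (Function.LeftInverse.injective (toEuclideanLin_transpose_apply_apply hU)),
    finrank_euclideanSpace_fin]

end Isometry

section Diagonal

variable {p n : ℕ} {q : Fin p → ℝ}

theorem norm_diagonal_le {κ : ℝ} (hκ : 0 ≤ κ) (hq : ∀ i, q i ∈ Set.Icc 0 κ) :
    ‖Matrix.diagonal q‖ ≤ κ := by
  rw [Matrix.l2_opNorm_diagonal, pi_norm_le_iff_of_nonneg hκ]
  exact fun i => (Real.norm_of_nonneg (hq i).1).trans_le (hq i).2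

theorem mul_norm_le_norm_diagonal_mul {α : ℝ} (hα : 0 < α) (hq : ∀ i, α ≤ q i)
    (M : Matrix (Fin p) (Fin n) ℝ) : α * ‖M‖ ≤ ‖Matrix.diagonal q * M‖ := by
  rw [← le_div_iff₀' hα]
  refine norm_le_of_toEuclideanLin M (by positivity) fun x => ?_
  rw [div_mul_eq_mul_div, le_div_iff₀' hα]
  refine le_trans ?_ (norm_toEuclideanLin_apply_le _ x)
  refine le_of_sq_le_sq ?_ (norm_nonneg _)
  rw [toEuclideanLin_mul_apply, mul_pow, EuclideanSpace.real_norm_sq_eq,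
    EuclideanSpace.real_norm_sq_eq, Finset.mul_sum]
  refine Finset.sum_le_sum fun i _ => ?_
  have diagonal_apply : toEuclideanLin (Matrix.diagonal q) (toEuclideanLin M x) i =
      q i * toEuclideanLin M x i := Matrix.mulVec_diagonal _ _ i
  rw [diagonal_apply, mul_pow]
  gcongr
  exact hq i

end Diagonal

section SpikedMatrix

/-- `B = U diag(q) Uᵀ + Γ` is a spiked matrix: `U` has orthonormal columns, the spikes `q i` lie in
`[α, κ]` and the bulk satisfies `0 ⪯ Γ ⪯ β I`. -/
structure IsSpiked {k p : ℕ} (B : Matrix (Fin k) (Fin k) ℝ) (U : Matrix (Fin k) (Fin p) ℝ)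
    (q : Fin p → ℝ) (Γ : Matrix (Fin k) (Fin k) ℝ) (α κ β : ℝ) : Prop where
  eq_add : B = U * Matrix.diagonal q * Uᵀ + Γ
  transpose_mul_self : Uᵀ * U = 1
  spike_mem : ∀ i, q i ∈ Set.Icc α κ
  bulk_posSemidef : Γ.PosSemidef
  bulk_le : (β • (1 : Matrix (Fin k) (Fin k) ℝ) - Γ).PosSemidef

namespace IsSpiked

variable {k p : ℕ} {B Γ : Matrix (Fin k) (Fin k) ℝ} {U : Matrix (Fin k) (Fin p) ℝ} {q : Fin p → ℝ}
  {α κ β : ℝ}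

theorem inner_apply (h : IsSpiked B U q Γ α κ β) (x : EuclideanSpace ℝ (Fin k)) :
    inner ℝ x (toEuclideanLin B x) =
      ∑ i, q i * toEuclideanLin Uᵀ x i ^ 2 + inner ℝ x (toEuclideanLin Γ x) := by
  rw [h.eq_add, map_add, LinearMap.add_apply, inner_add_right, Matrix.mul_assoc,
    toEuclideanLin_mul_apply, ← LinearMap.adjoint_inner_left, ← toEuclideanLin_transpose,
    toEuclideanLin_mul_apply, PiLp.inner_apply]
  congr 1
  refine Finset.sum_congr rfl fun i _ => ?_
  simp only [Matrix.toLpLin_apply, Matrix.mulVec_diagonal, RCLike.inner_apply, conj_trivial]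
  ring

theorem posSemidef (h : IsSpiked B U q Γ α κ β) (hα : 0 ≤ α) : B.PosSemidef := by
  rw [h.eq_add]
  refine Matrix.PosSemidef.add ?_ h.bulk_posSemidef
  have diagonal_posSemidef : (Matrix.diagonal q).PosSemidef :=
    Matrix.PosSemidef.diagonal fun i => hα.trans (h.spike_mem i).1
  simpa using diagonal_posSemidef.mul_mul_conjTranspose_same U

theorem norm_le (h : IsSpiked B U q Γ α κ β) (hα : 0 ≤ α) (hκ : 0 ≤ κ) (hβ : 0 ≤ β) :
    ‖B‖ ≤ κ + β := by
  have hU := norm_le_one_of_transpose_mul_self_eq_one h.transpose_mul_self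
  rw [h.eq_add]
  refine (norm_add_le _ _).trans
    (add_le_add ?_ (norm_le_of_posSemidef hβ h.bulk_posSemidef h.bulk_le))
  calc ‖U * Matrix.diagonal q * Uᵀ‖ ≤ ‖U‖ * ‖Matrix.diagonal q‖ * ‖Uᵀ‖ :=
        (Matrix.l2_opNorm_mul _ _).trans (by gcongr; exact Matrix.l2_opNorm_mul _ _)
    _ ≤ 1 * κ * 1 := by
        rw [norm_transpose]
        gcongr
        exact norm_diagonal_le hκ fun i => ⟨hα.trans (h.spike_mem i).1, (h.spike_mem i).2⟩
    _ = κ := by ring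

theorem spike_le_norm (h : IsSpiked B U q Γ α κ β) (hα : 0 ≤ α) (i : Fin p) : q i ≤ ‖B‖ := by
  set x := toEuclideanLin U (EuclideanSpace.single i 1)
  have norm_x : ‖x‖ = 1 := by
    rw [norm_toEuclideanLin_apply_eq h.transpose_mul_self]
    simp
  calc q i = q i * toEuclideanLin Uᵀ x i ^ 2 := by
        simp [x, toEuclideanLin_transpose_apply_apply h.transpose_mul_self]
    _ ≤ ∑ j, q j * toEuclideanLin Uᵀ x j ^ 2 :=
        Finset.single_le_sum (f := fun j => q j * toEuclideanLin Uᵀ x j ^ 2)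
          (fun j _ => mul_nonneg (hα.trans (h.spike_mem j).1) (sq_nonneg _)) (Finset.mem_univ i)
    _ ≤ inner ℝ x (toEuclideanLin B x) := by
        rw [h.inner_apply]
        exact le_add_of_nonneg_right (inner_toEuclideanLin_nonneg h.bulk_posSemidef x)
    _ ≤ ‖x‖ * (‖B‖ * ‖x‖) := (real_inner_le_norm _ _).trans
        (by gcongr; exact norm_toEuclideanLin_apply_le B x)
    _ = ‖B‖ := by rw [norm_x, one_mul, mul_one]

theorem mul_norm_transpose_mul_le {n : ℕ} (h : IsSpiked B U q Γ α κ β) (hα : 0 < α) (hβ : 0 ≤ β)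
    (P : Matrix (Fin k) (Fin n) ℝ) : α * ‖Uᵀ * P‖ ≤ ‖B * P‖ + β * ‖P‖ := by
  have diagonal_mul_eq : Matrix.diagonal q * (Uᵀ * P) = Uᵀ * (B * P - Γ * P) := by
    rw [← Matrix.sub_mul, h.eq_add, add_sub_cancel_right]
    simp only [← Matrix.mul_assoc, h.transpose_mul_self, Matrix.one_mul]
  calc α * ‖Uᵀ * P‖ ≤ ‖Matrix.diagonal q * (Uᵀ * P)‖ :=
        mul_norm_le_norm_diagonal_mul hα (fun i => (h.spike_mem i).1) _
    _ ≤ ‖Uᵀ‖ * ‖B * P - Γ * P‖ := diagonal_mul_eq ▸ Matrix.l2_opNorm_mul _ _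
    _ ≤ 1 * (‖B * P‖ + ‖Γ‖ * ‖P‖) := by
        gcongr
        · exact (norm_transpose U).trans_le
            (norm_le_one_of_transpose_mul_self_eq_one h.transpose_mul_self)
        · exact (norm_sub_le _ _).trans (by gcongr; exact Matrix.l2_opNorm_mul _ _)
    _ ≤ ‖B * P‖ + β * ‖P‖ := by
        rw [one_mul]
        gcongr
        exact norm_le_of_posSemidef hβ h.bulk_posSemidef h.bulk_le

theorem le_card_le_eigenvalues (h : IsSpiked B U q Γ α κ β) (hB : B.IsHermitian) :
    p ≤ (Finset.univ.filter fun i => α ≤ hB.eigenvalues i).card := by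
  refine (finrank_range_of_transpose_mul_self_eq_one h.transpose_mul_self).ge.trans
    (finrank_le_card_le_eigenvalues hB.eigenvectorBasis _ α _ ?_)
  rintro _ ⟨y, rfl⟩
  rw [← inner_toEuclideanLin_eq_sum_eigenvalues, h.inner_apply,
    norm_toEuclideanLin_apply_eq h.transpose_mul_self,
    toEuclideanLin_transpose_apply_apply h.transpose_mul_self, EuclideanSpace.real_norm_sq_eq,
    Finset.mul_sum]
  refine le_add_of_le_of_nonneg (Finset.sum_le_sum fun i _ => ?_)
    (inner_toEuclideanLin_nonneg h.bulk_posSemidef _)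
  exact mul_le_mul_of_nonneg_right (h.spike_mem i).1 (sq_nonneg _)

theorem le_add_card_eigenvalues_le (h : IsSpiked B U q Γ α κ β) (hB : B.IsHermitian) :
    k ≤ p + (Finset.univ.filter fun i => hB.eigenvalues i ≤ β).card := by
  set T := toEuclideanLin Uᵀ
  have rank_nullity := LinearMap.finrank_range_add_finrank_ker T
  have finrank_range_le := Submodule.finrank_le (LinearMap.range T)
  rw [finrank_euclideanSpace_fin] at rank_nullity finrank_range_le
  suffices finrank ℝ (LinearMap.ker T) ≤
      (Finset.univ.filter fun i => -β ≤ -hB.eigenvalues i).card by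
    simp only [neg_le_neg_iff] at this
    omega
  refine finrank_le_card_le_eigenvalues hB.eigenvectorBasis _ (-β) _ fun x hx => ?_
  simp only [neg_mul, Finset.sum_neg_distrib, neg_le_neg_iff,
    ← inner_toEuclideanLin_eq_sum_eigenvalues, h.inner_apply]
  have T_apply : toEuclideanLin Uᵀ x = 0 := hx
  simpa [T_apply] using inner_toEuclideanLin_le h.bulk_le x

theorem card_lt_eigenvalues_le (h : IsSpiked B U q Γ α κ β) (hB : B.IsHermitian) :
    (Finset.univ.filter fun i => β < hB.eigenvalues i).card ≤ p := by
  have card_add := Finset.card_filter_add_card_filter_not (s := (Finset.univ : Finset (Fin k)))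
    fun i => hB.eigenvalues i ≤ β
  simp only [not_le, Finset.card_univ, Fintype.card_fin] at card_add
  have := h.le_add_card_eigenvalues_le hB
  lia

theorem le_eigenvalues_of_lt (h : IsSpiked B U q Γ α κ β) (hB : B.IsHermitian) (hβα : β < α)
    {i : Fin k} (hi : β < hB.eigenvalues i) : α ≤ hB.eigenvalues i := by
  have filter_subset : (Finset.univ.filter fun i => α ≤ hB.eigenvalues i) ⊆
      Finset.univ.filter fun i => β < hB.eigenvalues i :=
    Finset.monotone_filter_right _ fun _ _ => hβα.trans_le
  have filter_eq := Finset.eq_of_subset_of_card_le filter_subset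
    ((h.card_lt_eigenvalues_le hB).trans (h.le_card_le_eigenvalues hB))
  simpa using filter_eq.ge (by simpa using hi : i ∈ _)

end IsSpiked

end SpikedMatrix

section GradientFilter

theorem mul_one_sub_pow_le {η x α N : ℝ} (t : ℕ) (hη : 0 ≤ η) (hx : 0 ≤ x) (hαx : α ≤ x)
    (hxN : x ≤ N) (hηN : η * N ≤ 1) : x * (1 - η * x) ^ t ≤ N * Real.exp (-(t * (η * α))) := by
  have one_sub_nonneg : 0 ≤ 1 - η * x :=
    sub_nonneg.2 ((mul_le_mul_of_nonneg_left hxN hη).trans hηN)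
  have pow_le : (1 - η * x) ^ t ≤ Real.exp (-(t * (η * α))) := by
    calc (1 - η * x) ^ t ≤ Real.exp (-(η * x)) ^ t := by
          gcongr
          exact Real.one_sub_le_exp_neg _
      _ = Real.exp (-(t * (η * x))) := by rw [← Real.exp_nat_mul, mul_neg]
      _ ≤ Real.exp (-(t * (η * α))) := by gcongr
  exact mul_le_mul hxN pow_le (by positivity) (hx.trans hxN)

theorem exp_neg_le_one_sub {y : ℝ} (hy₀ : 0 ≤ y) (hy : 2 * y ≤ 1) :
    Real.exp (-(2 * y)) ≤ 1 - y := by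
  have one_sub_pos : 0 < 1 - y := by linarith
  rw [← Real.le_log_iff_exp_le one_sub_pos]
  refine le_trans ?_ (Real.one_sub_inv_le_log_of_pos one_sub_pos)
  rw [neg_le_sub_iff_le_add, inv_le_iff_one_le_mul₀ one_sub_pos]
  nlinarith

theorem exp_neg_le_one_sub_pow {η x β : ℝ} (t : ℕ) (hη : 0 ≤ η) (hx : 0 ≤ x) (hxβ : x ≤ β)
    (hηβ : 2 * (η * β) ≤ 1) : Real.exp (-(2 * (t * (η * β)))) ≤ (1 - η * x) ^ t := by
  have hβ : 0 ≤ η * β := mul_nonneg hη (hx.trans hxβ)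
  calc Real.exp (-(2 * (t * (η * β)))) = Real.exp (-(2 * (η * β))) ^ t := by
        rw [← Real.exp_nat_mul]
        ring_nf
    _ ≤ (1 - η * β) ^ t := by
        gcongr
        exact exp_neg_le_one_sub hβ hηβ
    _ ≤ (1 - η * x) ^ t := by
        gcongr
        linarith

variable {k p : ℕ} {B : Matrix (Fin k) (Fin k) ℝ} {η β : ℝ}

theorem one_sub_mul_eigenvalues_mem_Icc (hB : B.PosSemidef) (hη : 0 ≤ η) (hηB : η * ‖B‖ ≤ 1)
    (i : Fin k) : 1 - η * hB.isHermitian.eigenvalues i ∈ Set.Icc 0 1 := by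
  have ev_le : hB.isHermitian.eigenvalues i ≤ ‖B‖ :=
    (le_abs_self _).trans (abs_eigenvalues_le_norm hB.isHermitian i)
  exact ⟨sub_nonneg.2 ((mul_le_mul_of_nonneg_left ev_le hη).trans hηB),
    sub_le_self 1 (mul_nonneg hη (hB.eigenvalues_nonneg i))⟩

theorem norm_one_sub_smul_pow_le_one (hB : B.PosSemidef) (hη : 0 ≤ η) (hηB : η * ‖B‖ ≤ 1)
    (t : ℕ) : ‖(1 - η • B) ^ t‖ ≤ 1 := by
  rw [one_sub_smul_pow_eq_cfc hB.isHermitian]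
  refine norm_cfc_le_of_eigenvalues hB.isHermitian zero_le_one fun i => ?_
  obtain ⟨factor_nonneg, factor_le_one⟩ := one_sub_mul_eigenvalues_mem_Icc hB hη hηB i
  rw [abs_of_nonneg (pow_nonneg factor_nonneg t)]
  exact pow_le_one₀ factor_nonneg factor_le_one

theorem IsSpiked.norm_mul_one_sub_smul_pow_le {U : Matrix (Fin k) (Fin p) ℝ} {q : Fin p → ℝ}
    {Γ : Matrix (Fin k) (Fin k) ℝ} {α κ K : ℝ} {t : ℕ} (h : IsSpiked B U q Γ α κ β) (hβ : 0 ≤ β)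
    (hβα : β < α) (hη : 0 ≤ η) (hηB : η * ‖B‖ ≤ 1) (hβK : β ≤ K)
    (hK : ‖B‖ * Real.exp (-(t * (η * α))) ≤ K) : ‖B * (1 - η • B) ^ t‖ ≤ K := by
  have hB := h.posSemidef (hβ.trans hβα.le)
  have hB_self : IsSelfAdjoint B := hB.isHermitian
  rw [one_sub_smul_pow_eq_cfc hB.isHermitian]
  nth_rw 1 [← cfc_id ℝ B]
  rw [← cfc_mul ..]
  refine norm_cfc_le_of_eigenvalues hB.isHermitian (hβ.trans hβK) fun i => ?_
  obtain ⟨factor_nonneg, factor_le_one⟩ := one_sub_mul_eigenvalues_mem_Icc hB hη hηB i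
  have ev_nonneg := hB.eigenvalues_nonneg i
  rw [id, abs_of_nonneg (mul_nonneg ev_nonneg (pow_nonneg factor_nonneg t))]
  rcases le_or_gt (hB.isHermitian.eigenvalues i) β with bulk | spike
  · exact (mul_le_of_le_one_right ev_nonneg (pow_le_one₀ factor_nonneg factor_le_one)).trans
      (bulk.trans hβK)
  · exact (mul_one_sub_pow_le t hη ev_nonneg (h.le_eigenvalues_of_lt hB.isHermitian hβα spike)
      ((le_abs_self _).trans (abs_eigenvalues_le_norm hB.isHermitian i)) hηB).trans hK

/-- The inverse of the gradient descent filter `(1 - η B) ^ t` on the spectral subspace of `B` for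
the eigenvalues at most `β`, extended by zero. -/
noncomputable def bulkInverse (B : Matrix (Fin k) (Fin k) ℝ) (η β : ℝ) (t : ℕ) :
    Matrix (Fin k) (Fin k) ℝ :=
  cfc (fun x => if x ≤ β then ((1 - η * x) ^ t)⁻¹ else 0) B

theorem norm_bulkInverse_le (hB : B.PosSemidef) (hη : 0 ≤ η) (hηβ : 2 * (η * β) ≤ 1) (t : ℕ) :
    ‖bulkInverse B η β t‖ ≤ Real.exp (2 * (t * (η * β))) := by
  refine norm_cfc_le_of_eigenvalues hB.isHermitian (Real.exp_pos _).le fun i => ?_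
  split_ifs with bulk
  · have exp_le := exp_neg_le_one_sub_pow t hη (hB.eigenvalues_nonneg i) bulk hηβ
    have pow_pos := (Real.exp_pos _).trans_le exp_le
    rwa [abs_of_pos (inv_pos.2 pow_pos), inv_le_comm₀ pow_pos (Real.exp_pos _), ← Real.exp_neg]
  · rw [abs_zero]
    exact (Real.exp_pos _).le

theorem toEuclideanLin_pow_mul_bulkInverse (hB : B.IsHermitian) (hη : 0 ≤ η) (hηβ : η * β < 1)
    (t : ℕ) {x : EuclideanSpace ℝ (Fin k)}
    (hx : ∀ i, β < hB.eigenvalues i → inner ℝ (hB.eigenvectorBasis i) x = 0) :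
    toEuclideanLin ((1 - η • B) ^ t * bulkInverse B η β t) x = x := by
  rw [one_sub_smul_pow_eq_cfc hB, bulkInverse, toEuclideanLin_mul_apply,
    toEuclideanLin_cfc_apply hB fun y => if y ≤ β then ((1 - η * y) ^ t)⁻¹ else 0, map_sum]
  conv_rhs => rw [← hB.eigenvectorBasis.sum_repr' x]
  refine Finset.sum_congr rfl fun i _ => ?_
  rw [map_smul, toEuclideanLin_cfc_eigenvectorBasis, smul_smul]
  congr 1
  split_ifs with bulk
  · have factor_pos : 0 < 1 - η * hB.eigenvalues i :=
      sub_pos.2 ((mul_le_mul_of_nonneg_left bulk hη).trans_lt hηβ)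
    field_simp
  · rw [hx i (not_le.1 bulk), zero_mul, zero_mul]

end GradientFilter

section SpikedModel

variable {k p : ℕ}

/-- `M` acts, off the low-dimensional space `D` and up to a right factor of norm at most `ρ`, like
the bulk matrix `S`, and it is the sum of a spike part `V * Y` with `‖Y‖ ≤ κ` and of a bulk part of
norm at most `σ`. This is what is used about the matrix `M` in the gradient `-Wbar * M`. -/
structure IsFilteredBulk (D : Submodule ℝ (EuclideanSpace ℝ (Fin k)))
    (V : Matrix (Fin k) (Fin p) ℝ) (S : Matrix (Fin k) (Fin k) ℝ) (κ σ ρ : ℝ)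
    (M : Matrix (Fin k) (Fin k) ℝ) : Prop where
  exists_eq_add : ∃ (Y : Matrix (Fin p) (Fin k) ℝ) (T : Matrix (Fin k) (Fin k) ℝ),
    M = V * Y + T ∧ ‖Y‖ ≤ κ ∧ ‖T‖ ≤ σ
  exists_mul_apply_eq : ∃ R : Matrix (Fin k) (Fin k) ℝ, ‖R‖ ≤ ρ ∧
    ∀ x ∈ Dᗮ, toEuclideanLin (M * R) x = toEuclideanLin S x

theorem IsFilteredBulk.mono {D : Submodule ℝ (EuclideanSpace ℝ (Fin k))}
    {V : Matrix (Fin k) (Fin p) ℝ} {S M : Matrix (Fin k) (Fin k) ℝ} {κ κ' σ ρ ρ' : ℝ}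
    (hM : IsFilteredBulk D V S κ σ ρ M) (hκ : κ ≤ κ') (hρ : ρ ≤ ρ') :
    IsFilteredBulk D V S κ' σ ρ' M := by
  obtain ⟨⟨Y, T, M_eq, hY, hT⟩, R, hR, hMR⟩ := hM
  exact ⟨⟨Y, T, M_eq, hY.trans hκ, hT⟩, R, hR.trans hρ, hMR⟩

theorem IsFilteredBulk.frobNorm_mul_sq_le {m : ℕ} {D : Submodule ℝ (EuclideanSpace ℝ (Fin k))}
    {V : Matrix (Fin k) (Fin p) ℝ} {S M : Matrix (Fin k) (Fin k) ℝ} {κ σ ρ : ℝ}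
    (hM : IsFilteredBulk D V S κ σ ρ M) (W : Matrix (Fin m) (Fin k) ℝ) :
    frobNorm (W * M) ^ 2 ≤ 2 * (κ ^ 2 * frobNorm (W * V) ^ 2) + 2 * (σ ^ 2 * frobNorm W ^ 2) := by
  obtain ⟨Y, T, rfl, hY, hT⟩ := hM.exists_eq_add
  rw [Matrix.mul_add, ← Matrix.mul_assoc]
  calc frobNorm (W * V * Y + W * T) ^ 2
      ≤ 2 * frobNorm (W * V * Y) ^ 2 + 2 * frobNorm (W * T) ^ 2 := frobNorm_add_sq_le _ _
    _ ≤ 2 * (‖Y‖ ^ 2 * frobNorm (W * V) ^ 2) + 2 * (‖T‖ ^ 2 * frobNorm W ^ 2) := by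
        gcongr <;> exact MultiSpike.frobNorm_mul_sq_le _ _
    _ ≤ _ := by gcongr

theorem IsSpiked.exists_submodule {B Γ : Matrix (Fin k) (Fin k) ℝ} {U : Matrix (Fin k) (Fin p) ℝ}
    {q : Fin p → ℝ} {α κ β : ℝ} (h : IsSpiked B U q Γ α κ β) (hB : B.IsHermitian) :
    ∃ D : Submodule ℝ (EuclideanSpace ℝ (Fin k)), finrank ℝ D ≤ 2 * p ∧
      ∀ x ∈ Dᗮ, toEuclideanLin Uᵀ x = 0 ∧
        ∀ i, β < hB.eigenvalues i → inner ℝ (hB.eigenvectorBasis i) x = 0 := by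
  classical
  set J := (Finset.univ.filter fun i => β < hB.eigenvalues i).image hB.eigenvectorBasis
  refine ⟨LinearMap.range (toEuclideanLin U) ⊔ Submodule.span ℝ J, ?_, fun x hx => ⟨?_, ?_⟩⟩
  · rw [two_mul]
    refine (Submodule.finrank_add_le_finrank_add_finrank _ _).trans (Nat.add_le_add ?_ ?_)
    · exact (finrank_range_of_transpose_mul_self_eq_one h.transpose_mul_self).le
    · exact (finrank_span_finset_le_card J).trans
        (Finset.card_image_le.trans (h.card_lt_eigenvalues_le hB))
  · rw [← inner_self_eq_zero (𝕜 := ℝ), toEuclideanLin_transpose, LinearMap.adjoint_inner_right]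
    exact hx _ (Submodule.mem_sup_left ⟨_, rfl⟩)
  · intro i hi
    exact hx _ (Submodule.mem_sup_right (Submodule.subset_span (by simpa [J] using ⟨i, hi, rfl⟩)))

theorem IsSpiked.isFilteredBulk {B Γ H S : Matrix (Fin k) (Fin k) ℝ}
    {U V : Matrix (Fin k) (Fin p) ℝ} {q qbar : Fin p → ℝ} {α κ β τ σ η K : ℝ} {t : ℕ}
    {D : Submodule ℝ (EuclideanSpace ℝ (Fin k))} (h : IsSpiked B U q Γ α κ β)
    (hB : B.PosSemidef) (hβ : 0 ≤ β) (hβα : β < α) (hH : H = V * Matrix.diagonal qbar * Uᵀ + S)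
    (hτ : 0 ≤ τ) (hqbar : ∀ i, qbar i ∈ Set.Icc 0 τ) (hS : ‖S‖ ≤ σ) (hη : 0 ≤ η)
    (hηB : η * ‖B‖ ≤ 1) (hηβ : 2 * (η * β) ≤ 1) (hβK : β ≤ K)
    (hK : ‖B‖ * Real.exp (-(t * (η * α))) ≤ K)
    (hD : ∀ x ∈ Dᗮ, toEuclideanLin Uᵀ x = 0 ∧
      ∀ i, β < hB.isHermitian.eigenvalues i → inner ℝ (hB.isHermitian.eigenvectorBasis i) x = 0) :
    IsFilteredBulk D V S (τ * ((K + β) / α)) σ (Real.exp (2 * (t * (η * β))))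
      (H * (1 - η • B) ^ t) := by
  have hα : 0 < α := hβ.trans_lt hβα
  set P := (1 - η • B) ^ t with P_def
  have P_le : ‖P‖ ≤ 1 := norm_one_sub_smul_pow_le_one hB hη hηB t
  have UP_le : ‖Uᵀ * P‖ ≤ (K + β) / α := by
    rw [le_div_iff₀' hα]
    refine (h.mul_norm_transpose_mul_le hα hβ P).trans (add_le_add ?_ ?_)
    · exact h.norm_mul_one_sub_smul_pow_le hβ hβα hη hηB hβK hK
    · exact mul_le_of_le_one_right hβ P_le
  refine ⟨⟨Matrix.diagonal qbar * (Uᵀ * P), S * P, ?_, ?_, ?_⟩,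
    bulkInverse B η β t, norm_bulkInverse_le hB hη hηβ t, fun x hx => ?_⟩
  · simp only [hH, Matrix.add_mul, Matrix.mul_assoc]
  · refine (Matrix.l2_opNorm_mul _ _).trans ?_
    gcongr
    exact norm_diagonal_le hτ hqbar
  · exact (Matrix.l2_opNorm_mul _ _).trans ((mul_le_of_le_one_right (norm_nonneg S) P_le).trans hS)
  · obtain ⟨orthogonal_U, orthogonal_ev⟩ := hD x hx
    rw [Matrix.mul_assoc, toEuclideanLin_mul_apply, P_def,
      toEuclideanLin_pow_mul_bulkInverse hB.isHermitian hη (by linarith [mul_nonneg hη hβ]) t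
        orthogonal_ev, hH, map_add, LinearMap.add_apply, toEuclideanLin_mul_apply, orthogonal_U,
      map_zero, zero_add]

theorem mul_exp_neg_le_of_log_le {d N c₁ c₂ c ℓ u s : ℝ} (hd : 1 ≤ d) (hc₁ : 0 < c₁)
    (hc₂ : 0 < c₂) (hc : 0 < c) (hu : u ≤ 1) (hN : 0 < N) (hN_le : N ≤ 2 * c₂ * d ^ u)
    (hs : 2 * c * c₂ / c₁ * d ^ (u - ℓ) * Real.log d ≤ s) :
    N * Real.exp (-(s * (1 / (c * N) * (c₁ * d ^ ℓ)))) ≤ 2 * c₂ := by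
  have hd₀ : 0 < d := one_pos.trans_le hd
  have log_le : Real.log d ≤ s * (1 / (c * N) * (c₁ * d ^ ℓ)) := by
    calc Real.log d ≤ 2 * c₂ * d ^ u / N * Real.log d :=
          le_mul_of_one_le_left (Real.log_nonneg hd) ((one_le_div₀ hN).2 hN_le)
      _ = 2 * c * c₂ / c₁ * d ^ (u - ℓ) * Real.log d * (1 / (c * N) * (c₁ * d ^ ℓ)) := by
          rw [Real.rpow_sub hd₀]
          field_simp
      _ ≤ _ := by gcongr
  calc N * Real.exp (-(s * (1 / (c * N) * (c₁ * d ^ ℓ))))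
      ≤ 2 * c₂ * d * Real.exp (-Real.log d) := by
        gcongr
        exact hN_le.trans (by gcongr; exact Real.rpow_le_self_of_one_le hd hu)
    _ = 2 * c₂ := by
        rw [Real.exp_neg, Real.exp_log hd₀, mul_inv_cancel_right₀ hd₀.ne']

theorem two_mul_mul_le_of_le {d N c₁ c₂ c C u s : ℝ} (hd : 0 < d) (hc₁ : 0 < c₁)
    (hc₂ : 0 ≤ c₂) (hc : 0 < c) (hN : c₁ * d ^ u ≤ N) (hs₀ : 0 ≤ s) (hs : s ≤ C * d ^ u) :
    2 * (s * (1 / (c * N) * c₂)) ≤ 2 * C * c₂ / (c * c₁) := by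
  calc 2 * (s * (1 / (c * N) * c₂)) ≤ 2 * (s * (1 / (c * (c₁ * d ^ u)) * c₂)) := by gcongr
    _ ≤ 2 * (C * d ^ u * (1 / (c * (c₁ * d ^ u)) * c₂)) := by gcongr
    _ = 2 * C * c₂ / (c * c₁) := by field_simp

variable {d r n : ℕ} {c₁ c₂ ℓ u : ℝ} {A Abar : Matrix (Fin k) (Fin n) ℝ}

theorem MultiSpiked.exists_isSpiked (h : MultiSpiked d p r c₁ c₂ ℓ u A Abar) (hc₁ : 0 < c₁)
    (hr : 0 < r) :
    ∃ (U V : Matrix (Fin k) (Fin p) ℝ) (q qbar : Fin p → ℝ) (Γ S : Matrix (Fin k) (Fin k) ℝ),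
      IsSpiked (gram A) U q Γ (c₁ * (d : ℝ) ^ ℓ) (c₂ * (d : ℝ) ^ u) c₂ ∧
      c₁ * (d : ℝ) ^ u ≤ ‖gram A‖ ∧
      crossGram A Abar = V * Matrix.diagonal qbar * Uᵀ + S ∧ Vᵀ * V = 1 ∧
      (∀ i, qbar i ∈ Set.Icc 0 (c₂ * (d : ℝ) ^ u)) ∧ ‖S‖ ≤ c₂ ∧
      r * c₁ ^ 2 ≤ frobNorm S ^ 2 := by
  obtain ⟨_, _, Γ, S, U, V, q, qbar, gram_eq, crossGram_eq, hU, hV, -, -, rfl, rfl, hq, hqbar,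
    ⟨i, hi⟩, le_bulk, bulk_le, hS⟩ := h
  have bulk_posSemidef : Γ.PosSemidef := by
    simpa only [sub_add_cancel] using le_bulk.add (Matrix.PosSemidef.one.smul hc₁.le)
  have spiked : IsSpiked (gram A) U q Γ (c₁ * (d : ℝ) ^ ℓ) (c₂ * (d : ℝ) ^ u) c₂ :=
    ⟨gram_eq, hU, hq, bulk_posSemidef, bulk_le⟩
  have spike_nonneg : 0 ≤ c₁ * (d : ℝ) ^ ℓ := by positivity
  exact ⟨U, V, q, qbar, Γ, S, spiked, hi.trans (spiked.spike_le_norm spike_nonneg i), crossGram_eq,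
    hV, fun j => ⟨spike_nonneg.trans (hqbar j).1, (hqbar j).2⟩,
    (norm_le_singularValue_zero S).trans (hS 0 hr).2,
    mul_sq_le_frobNorm_sq S hc₁ fun j hj => (hS j hj).1⟩

theorem MultiSpiked.exists_isFilteredBulk {c C₃ : ℝ} (h : MultiSpiked d p r c₁ c₂ ℓ u A Abar)
    (hc₁ : 0 < c₁) (hc₂ : 0 < c₂) (hu₀ : 0 ≤ u) (hu : u ≤ 1) (hc : 1 ≤ c) (hd : 1 ≤ d)
    (hr : 0 < r) (hsep : c₂ < c₁ * (d : ℝ) ^ ℓ) (hstep : 2 * c₂ ≤ c₁ * (d : ℝ) ^ u) :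
    ∃ (D : Submodule ℝ (EuclideanSpace ℝ (Fin k))) (V : Matrix (Fin k) (Fin p) ℝ)
      (S : Matrix (Fin k) (Fin k) ℝ), finrank ℝ D ≤ 2 * p ∧ Vᵀ * V = 1 ∧ ‖S‖ ≤ c₂ ∧
      r * c₁ ^ 2 ≤ frobNorm S ^ 2 ∧
      ∀ t : ℕ, 2 * c * c₂ / c₁ * (d : ℝ) ^ (u - ℓ) * Real.log d ≤ t → t ≤ C₃ * (d : ℝ) ^ u →
        IsFilteredBulk D V S (3 * c₂ ^ 2 / c₁ * (d : ℝ) ^ (u - ℓ)) c₂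
          (Real.exp (2 * C₃ * c₂ / (c * c₁)))
          (crossGram A Abar * (1 - (1 / (c * opNorm (gram A))) • gram A) ^ t) := by
  obtain ⟨U, V, q, qbar, Γ, S, spiked, le_norm, crossGram_eq, hV, hqbar, hS, hS_frob⟩ :=
    h.exists_isSpiked hc₁ hr
  have hd₁ : (1 : ℝ) ≤ d := by exact_mod_cast hd
  have hd₀ : (0 : ℝ) < d := one_pos.trans_le hd₁
  have one_le_rpow : (1 : ℝ) ≤ (d : ℝ) ^ u := Real.one_le_rpow hd₁ hu₀
  have hB := spiked.posSemidef (by positivity)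
  have norm_pos : 0 < ‖gram A‖ := lt_of_lt_of_le (by positivity) le_norm
  have norm_le : ‖gram A‖ ≤ 2 * c₂ * (d : ℝ) ^ u := by
    refine (spiked.norm_le (by positivity) (by positivity) hc₂.le).trans ?_
    nlinarith
  have step_mul_norm : 1 / (c * ‖gram A‖) * ‖gram A‖ ≤ 1 := by
    rw [one_div, mul_inv, inv_mul_cancel_right₀ norm_pos.ne']
    exact inv_le_one_of_one_le₀ hc
  have step_mul_bulk : 2 * (1 / (c * ‖gram A‖) * c₂) ≤ 1 := by
    calc 2 * (1 / (c * ‖gram A‖) * c₂) = 1 / (c * ‖gram A‖) * (2 * c₂) := by ring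
      _ ≤ 1 / (c * ‖gram A‖) * ‖gram A‖ := by gcongr; exact hstep.trans le_norm
      _ ≤ 1 := step_mul_norm
  obtain ⟨D, finrank_le, hD⟩ := spiked.exists_submodule hB.isHermitian
  refine ⟨D, V, S, finrank_le, hV, hS, hS_frob, fun t le_t t_le => ?_⟩
  rw [show opNorm (gram A) = ‖gram A‖ from rfl]
  refine (spiked.isFilteredBulk hB hc₂.le hsep crossGram_eq (by positivity) hqbar hS (by positivity)
    step_mul_norm step_mul_bulk (by linarith : c₂ ≤ 2 * c₂)
    (mul_exp_neg_le_of_log_le hd₁ hc₁ hc₂ (by positivity) hu norm_pos norm_le le_t) hD).mono ?_ ?_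
  · rw [Real.rpow_sub hd₀]
    apply le_of_eq
    field_simp
    ring
  · exact Real.exp_le_exp.2 (two_mul_mul_le_of_le hd₀ hc₁ hc₂.le (by positivity) le_norm
      t.cast_nonneg t_le)

end SpikedModel

section ProductMeasure

variable {ι Ω : Type*} [Fintype ι] [MeasurableSpace Ω] (ρ : Measure Ω) [IsProbabilityMeasure ρ]

theorem memLp_sum_eval {X : ι → Ω → ℝ} (hX : ∀ i, MemLp (X i) 2 ρ) :
    MemLp (∑ i, fun ω : ι → Ω => X i (ω i)) 2 (Measure.pi fun _ => ρ) :=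
  memLp_finsetSum' _ fun i _ => (hX i).comp_measurePreserving (measurePreserving_eval _ i)

theorem integral_sum_eval {X : ι → Ω → ℝ} (hX : ∀ i, Integrable (X i) ρ) :
    ∫ ω, ∑ i, X i (ω i) ∂(Measure.pi fun _ => ρ) = ∑ i, ∫ x, X i x ∂ρ := by
  rw [integral_finsetSum _ fun i _ => integrable_comp_eval (hX i)]
  exact Finset.sum_congr rfl fun i _ => integral_comp_eval (hX i).aestronglyMeasurable

theorem pi_le_of_forall_update_le [DecidableEq ι] {s : Set (ι → Ω)} (hs : MeasurableSet s) (i : ι)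
    {ε : ENNReal} (h : ∀ ω, ρ {x | Function.update ω i x ∈ s} ≤ ε) :
    (Measure.pi fun _ => ρ) s ≤ ε := by
  rw [← lintegral_indicator_one hs]
  refine (lintegral_le_of_lmarginal_le (μ := fun _ => ρ) {i} (g := fun _ => ε)
    (measurable_one.indicator hs) measurable_const fun ω => ?_).trans_eq (by simp)
  have hsection : MeasurableSet {x | Function.update ω i x ∈ s} :=
    hs.preimage (measurable_update ω)
  rw [lmarginal_singleton, lmarginal_singleton, lintegral_const, measure_univ, mul_one]
  exact (lintegral_indicator_one hsection).trans_le (h ω)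

end ProductMeasure

section GaussianQuadraticForm

/-- The variance of the square of a standard Gaussian variable. -/
noncomputable def chiSqVar : ℝ := Var[fun x : ℝ => x ^ 2; gaussianReal 0 1]

theorem chiSqVar_nonneg : 0 ≤ chiSqVar := variance_nonneg _ _

theorem memLp_sq_gaussianReal : MemLp (fun x : ℝ => x ^ 2) 2 (gaussianReal 0 1) := by
  have four_div_two : (4 : ENNReal) / 2 = 2 := by
    rw [eq_comm, ENNReal.eq_div_iff (by simp) (by simp)]
    norm_num
  have := (memLp_id_gaussianReal' (μ := 0) (v := 1) 4 (by simp)).norm_rpow_div 2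
  rw [four_div_two] at this
  exact this.congr_norm (by fun_prop) (ae_of_all _ fun x => by simp)

theorem integral_sq_gaussianReal : ∫ x : ℝ, x ^ 2 ∂gaussianReal 0 1 = 1 := by
  have := variance_fun_id_gaussianReal (μ := 0) (v := 1)
  rw [variance_eq_integral (by fun_prop)] at this
  simpa using this

variable {E F : Type*} [NormedAddCommGroup E] [InnerProductSpace ℝ E] [FiniteDimensional ℝ E]
  [MeasurableSpace E] [BorelSpace E] [NormedAddCommGroup F] [InnerProductSpace ℝ F]
  {ι : Type*} [Fintype ι]

theorem identDistrib_norm_sq_apply_stdGaussian (T : E →ₗ[ℝ] F) (v : OrthonormalBasis ι ℝ E)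
    (horth : Pairwise fun i j => inner ℝ (T (v i)) (T (v j)) = 0) :
    IdentDistrib (fun x => ‖T x‖ ^ 2) (∑ i, fun x : ι → ℝ => ‖T (v i)‖ ^ 2 * x i ^ 2)
      (stdGaussian E) (Measure.pi fun _ => gaussianReal 0 1) := by
  have hT := T.continuous_of_finiteDimensional
  have hmeas : Measurable fun x => ‖T x‖ ^ 2 := (by fun_prop : Continuous _).measurable
  have hcomp : (fun x => ‖T x‖ ^ 2) ∘ (fun x : ι → ℝ => ∑ i, x i • v i) =
      ∑ i, fun x : ι → ℝ => ‖T (v i)‖ ^ 2 * x i ^ 2 := by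
    ext x
    rw [Function.comp_apply, norm_sq_apply_eq_sum T v horth, Finset.sum_apply]
    simp_rw [v.orthonormal.inner_right_fintype, mul_comm]
  refine ⟨hmeas.aemeasurable, by fun_prop, ?_⟩
  rw [stdGaussian_eq_map_pi_orthonormalBasis v, Measure.map_map (by fun_prop) (by fun_prop), hcomp]

variable [FiniteDimensional ℝ F] (T : E →ₗ[ℝ] F)

theorem memLp_norm_sq_apply_stdGaussian : MemLp (fun x => ‖T x‖ ^ 2) 2 (stdGaussian E) := by
  obtain ⟨v, -, horth⟩ := exists_orthonormalBasis_norm_apply_eq_singularValues T rfl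
  exact (identDistrib_norm_sq_apply_stdGaussian T v horth).memLp_iff.2
    (memLp_sum_eval _ fun _ => memLp_sq_gaussianReal.const_mul _)

theorem integral_norm_sq_apply_stdGaussian (b : OrthonormalBasis ι ℝ E) :
    ∫ x, ‖T x‖ ^ 2 ∂stdGaussian E = ∑ i, ‖T (b i)‖ ^ 2 := by
  obtain ⟨v, -, horth⟩ := exists_orthonormalBasis_norm_apply_eq_singularValues T rfl
  rw [(identDistrib_norm_sq_apply_stdGaussian T v horth).integral_eq, sum_sq_norm_apply_eq T b v]
  simp only [Finset.sum_apply]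
  rw [integral_sum_eval (X := fun i x => ‖T (v i)‖ ^ 2 * x ^ 2) _ fun _ =>
    (memLp_sq_gaussianReal.const_mul _).integrable one_le_two]
  simp only [integral_const_mul, integral_sq_gaussianReal, mul_one]

theorem variance_norm_sq_apply_stdGaussian_le {K : ℝ} (hK : ∀ x, ‖T x‖ ≤ K * ‖x‖) :
    Var[fun x => ‖T x‖ ^ 2; stdGaussian E] ≤ finrank ℝ E * K ^ 4 * chiSqVar := by
  obtain ⟨v, -, horth⟩ := exists_orthonormalBasis_norm_apply_eq_singularValues T rfl
  rw [(identDistrib_norm_sq_apply_stdGaussian T v horth).variance_eq,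
    variance_sum_pi (X := fun i x => ‖T (v i)‖ ^ 2 * x ^ 2) fun _ =>
      memLp_sq_gaussianReal.const_mul _]
  calc ∑ i, Var[fun x : ℝ => ‖T (v i)‖ ^ 2 * x ^ 2; gaussianReal 0 1]
      = ∑ i, ‖T (v i)‖ ^ 4 * chiSqVar := by
        refine Finset.sum_congr rfl fun i _ => ?_
        rw [variance_const_mul, ← pow_mul, chiSqVar]
    _ ≤ ∑ _ : Fin (finrank ℝ E), K ^ 4 * chiSqVar := by
        gcongr with i _
        · exact chiSqVar_nonneg
        · simpa using hK (v i)
    _ = finrank ℝ E * K ^ 4 * chiSqVar := by simp [mul_assoc]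

theorem stdGaussian_norm_sq_lt_le {K h s : ℝ} (hK : ∀ x, ‖T x‖ ≤ K * ‖x‖)
    (b : OrthonormalBasis ι ℝ E) (hT : h ≤ ∑ i, ‖T (b i)‖ ^ 2) (hs : s < h) :
    stdGaussian E {x | ‖T x‖ ^ 2 < s} ≤
      ENNReal.ofReal (finrank ℝ E * K ^ 4 * chiSqVar / (h - s) ^ 2) := by
  have chebyshev := meas_ge_le_variance_div_sq (memLp_norm_sq_apply_stdGaussian T)
    (sub_pos.2 hs)
  refine (measure_mono fun x hx => ?_).trans (chebyshev.trans (ENNReal.ofReal_le_ofReal ?_))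
  · rw [Set.mem_ofPred_eq] at hx ⊢
    rw [integral_norm_sq_apply_stdGaussian T b, abs_sub_comm]
    exact le_trans (by linarith) (le_abs_self _)
  · gcongr
    exact variance_norm_sq_apply_stdGaussian_le T hK

variable {m : ℕ}

theorem pi_stdGaussian_add_le_sum_norm_sq_le {K s : ℝ} (hK : ∀ x, ‖T x‖ ≤ K * ‖x‖)
    (b : OrthonormalBasis ι ℝ E) (hs : 0 < s) :
    (Measure.pi fun _ : Fin m => stdGaussian E)
      {x | m * ∑ j, ‖T (b j)‖ ^ 2 + s ≤ ∑ i, ‖T (x i)‖ ^ 2} ≤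
        ENNReal.ofReal (m * (finrank ℝ E * K ^ 4 * chiSqVar) / s ^ 2) := by
  have hmem := memLp_norm_sq_apply_stdGaussian T
  have chebyshev := meas_ge_le_variance_div_sq
    (memLp_sum_eval (stdGaussian E) fun _ : Fin m => hmem) hs
  rw [variance_sum_pi fun _ => hmem] at chebyshev
  simp only [Finset.sum_apply] at chebyshev
  rw [integral_sum_eval (X := fun _ x => ‖T x‖ ^ 2) _ fun _ => hmem.integrable one_le_two]
    at chebyshev
  refine (measure_mono fun x hx => ?_).trans (chebyshev.trans (ENNReal.ofReal_le_ofReal ?_))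
  · rw [Set.mem_ofPred_eq] at hx ⊢
    rw [integral_norm_sq_apply_stdGaussian T b, Finset.sum_const, Finset.card_fin, nsmul_eq_mul]
    exact le_trans (by linarith) (le_abs_self _)
  · gcongr
    rw [Finset.sum_const, Finset.card_fin, nsmul_eq_mul]
    gcongr
    exact variance_norm_sq_apply_stdGaussian_le T hK

theorem pi_stdGaussian_le_sum_norm_sq_le {s : ℝ} (b : OrthonormalBasis ι ℝ E) (hs : 0 < s) :
    (Measure.pi fun _ : Fin m => stdGaussian E) {x | s ≤ ∑ i, ‖T (x i)‖ ^ 2} ≤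
      ENNReal.ofReal (m * (∑ j, ‖T (b j)‖ ^ 2) / s) := by
  have hT := (memLp_norm_sq_apply_stdGaussian T).integrable one_le_two
  have markov := mul_meas_ge_le_integral_of_nonneg
    (μ := Measure.pi fun _ : Fin m => stdGaussian E) (f := fun x => ∑ i, ‖T (x i)‖ ^ 2)
    (ae_of_all _ fun x => by positivity)
    (integrable_finsetSum _ fun i _ =>
      integrable_comp_eval (μ := fun _ => stdGaussian E) (f := fun x => ‖T x‖ ^ 2) hT) s
  rw [integral_sum_eval (X := fun _ x => ‖T x‖ ^ 2) _ fun _ => hT,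
    integral_norm_sq_apply_stdGaussian T b, Finset.sum_const, Finset.card_fin, nsmul_eq_mul]
    at markov
  rw [← ofReal_measureReal]
  refine ENNReal.ofReal_le_ofReal ?_
  rwa [le_div_iff₀' hs]

end GaussianQuadraticForm

section NearSpan

variable {E F : Type*} [NormedAddCommGroup E] [InnerProductSpace ℝ E]
  [NormedAddCommGroup F] [InnerProductSpace ℝ F] {m : ℕ}

/-- The span of a subspace `D` and the members of a finite sequence that precede the `i`-th one. -/
def precedingSpan (D : Submodule ℝ E) (x : Fin m → E) (i : Fin m) : Submodule ℝ E :=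
  D ⊔ Submodule.span ℝ (x '' Set.Iio i)

/-- The `i`-th member of a sequence is within distance `τ` of the span of `D` and the members that
precede it. -/
def NearSpan (D : Submodule ℝ E) (τ : ℝ) (x : Fin m → E) (i : Fin m) : Prop :=
  ∃ z ∈ precedingSpan D x i, ‖x i - z‖ < τ

theorem mem_precedingSpan {D : Submodule ℝ E} {x : Fin m → E} {i : Fin m} {z : E} :
    z ∈ precedingSpan D x i ↔ ∃ y ∈ D, ∃ α : Fin m → ℝ, y + ∑ j ∈ Finset.Iio i, α j • x j = z := by
  simp only [precedingSpan, Submodule.mem_sup, ← Finset.coe_Iio,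
    Submodule.mem_span_image_finset_iff_exists_fun', exists_exists_eq_and]

theorem precedingSpan_mono (D : Submodule ℝ E) (x : Fin m → E) : Monotone (precedingSpan D x) :=
  fun _ _ hij => sup_le_sup_left (Submodule.span_mono (Set.image_mono (Set.Iio_subset_Iio hij))) _

theorem apply_mem_precedingSpan (D : Submodule ℝ E) (x : Fin m → E) {i j : Fin m} (hij : i < j) :
    x i ∈ precedingSpan D x j :=
  Submodule.mem_sup_right (Submodule.subset_span (Set.mem_image_of_mem x hij))

theorem precedingSpan_update_self (D : Submodule ℝ E) (x : Fin m → E) (i : Fin m) (y : E) :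
    precedingSpan D (Function.update x i y) i = precedingSpan D x i := by
  rw [precedingSpan, precedingSpan, Set.image_congr fun j hj => Function.update_of_ne hj.ne y x]

theorem finrank_precedingSpan_le [FiniteDimensional ℝ E] (D : Submodule ℝ E) (x : Fin m → E)
    (i : Fin m) : finrank ℝ (precedingSpan D x i) ≤ finrank ℝ D + i := by
  classical
  refine (Submodule.finrank_add_le_finrank_add_finrank _ _).trans ?_
  gcongr
  rw [← Finset.coe_Iio, ← Finset.coe_image]
  exact (finrank_span_finset_le_card _).trans (Finset.card_image_le.trans_eq (Fin.card_Iio i))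

theorem isOpen_nearSpan (D : Submodule ℝ E) (τ : ℝ) (i : Fin m) :
    IsOpen {x : Fin m → E | NearSpan D τ x i} := by
  have eq_iUnion : {x : Fin m → E | NearSpan D τ x i} =
      ⋃ z ∈ D, ⋃ α : Fin m → ℝ, {x | ‖x i - (z + ∑ j ∈ Finset.Iio i, α j • x j)‖ < τ} := by
    ext x
    simp [NearSpan, mem_precedingSpan]
  rw [eq_iUnion]
  exact isOpen_biUnion fun z _ => isOpen_iUnion fun α =>
    isOpen_lt (by fun_prop) continuous_const

variable [FiniteDimensional ℝ E] [FiniteDimensional ℝ F]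

theorem pairwise_inner_starProjection_precedingSpan (D : Submodule ℝ E) (x : Fin m → E) :
    Pairwise fun i j => inner ℝ ((precedingSpan D x i)ᗮ.starProjection (x i))
      ((precedingSpan D x j)ᗮ.starProjection (x j)) = 0 := by
  have of_lt (i j) (hij : i < j) : inner ℝ ((precedingSpan D x i)ᗮ.starProjection (x i))
      ((precedingSpan D x j)ᗮ.starProjection (x j)) = 0 := by
    refine Submodule.inner_right_of_mem_orthogonal (K := precedingSpan D x j) ?_
      (Submodule.starProjection_apply_mem _ _)
    rw [Submodule.starProjection_orthogonal_val]
    exact Submodule.sub_mem _ (apply_mem_precedingSpan D x hij)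
      (precedingSpan_mono D x hij.le (Submodule.starProjection_apply_mem _ _))
  intro i j hij
  rcases hij.lt_or_gt with h | h
  · exact of_lt i j h
  · exact (real_inner_comm _ _).trans (of_lt j i h)

theorem le_norm_starProjection_of_not_nearSpan {D : Submodule ℝ E} {τ : ℝ} {x : Fin m → E}
    {i : Fin m} (hi : ¬NearSpan D τ x i) : τ ≤ ‖(precedingSpan D x i)ᗮ.starProjection (x i)‖ := by
  rw [Submodule.starProjection_orthogonal_val]
  exact not_lt.1 fun hlt => hi ⟨_, Submodule.starProjection_apply_mem _ _, hlt⟩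

theorem exists_orthonormal_of_not_nearSpan (D : Submodule ℝ E) {τ : ℝ} (hτ : 0 < τ)
    (x : Fin m → E) (J : Finset (Fin m)) (hJ : ∀ i ∈ J, ¬NearSpan D τ x i) :
    ∃ q : J → E, (∀ i, q i ∈ Dᗮ) ∧ Orthonormal ℝ q ∧ ∀ i : J, τ ≤ inner ℝ (x i) (q i) := by
  let y (i : Fin m) : E := (precedingSpan D x i)ᗮ.starProjection (x i)
  have hyτ (i : J) : τ ≤ ‖y i‖ := le_norm_starProjection_of_not_nearSpan (hJ i i.2)
  have norm_y_ne_zero (i : J) : ‖y i‖ ≠ 0 := (hτ.trans_le (hyτ i)).ne'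
  refine ⟨fun i => ‖y i‖⁻¹ • y i, fun i => ?_, ⟨fun i => ?_, fun i j hij => ?_⟩, fun i => ?_⟩
  · exact Submodule.smul_mem _ _
      (Submodule.orthogonal_le le_sup_left (Submodule.starProjection_apply_mem _ _))
  · rw [norm_smul, norm_inv, norm_norm, inv_mul_cancel₀ (norm_y_ne_zero i)]
  · change inner ℝ (‖y i‖⁻¹ • y i) (‖y j‖⁻¹ • y j) = 0
    rw [real_inner_smul_left, real_inner_smul_right, pairwise_inner_starProjection_precedingSpan
      D x (Subtype.coe_injective.ne hij), mul_zero, mul_zero]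
  · have inner_eq : inner ℝ (x i) (y i) = ‖y i‖ ^ 2 := by
      rw [← real_inner_self_eq_norm_sq, Submodule.inner_starProjection_left_eq_right,
        Submodule.starProjection_eq_self_iff.2 (Submodule.starProjection_apply_mem _ _)]
    rw [real_inner_smul_right, inner_eq, sq, inv_mul_cancel_left₀ (norm_y_ne_zero i)]
    exact hyτ i

theorem norm_adjoint_apply_le {T : E →ₗ[ℝ] F} {K : ℝ} (hK₀ : 0 ≤ K) (hK : ∀ x, ‖T x‖ ≤ K * ‖x‖)
    (y : F) : ‖LinearMap.adjoint T y‖ ≤ K * ‖y‖ := by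
  have inner_le : ‖LinearMap.adjoint T y‖ * ‖LinearMap.adjoint T y‖ ≤
      ‖LinearMap.adjoint T y‖ * (K * ‖y‖) := by
    rw [← real_inner_self_eq_norm_mul_norm, LinearMap.adjoint_inner_right]
    calc inner ℝ (T (LinearMap.adjoint T y)) y ≤ ‖T (LinearMap.adjoint T y)‖ * ‖y‖ :=
          real_inner_le_norm _ _
      _ ≤ K * ‖LinearMap.adjoint T y‖ * ‖y‖ := by gcongr; exact hK _
      _ = ‖LinearMap.adjoint T y‖ * (K * ‖y‖) := by ring
  rcases (norm_nonneg (LinearMap.adjoint T y)).eq_or_lt with hzero | hpos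
  · exact hzero ▸ by positivity
  · exact le_of_mul_le_mul_left inner_le hpos

theorem sub_le_sum_norm_sq_starProjection {ι : Type*} [Fintype ι] {T : E →ₗ[ℝ] F} {K : ℝ}
    (hK₀ : 0 ≤ K) (hK : ∀ x, ‖T x‖ ≤ K * ‖x‖) (L : Submodule ℝ F) (b : OrthonormalBasis ι ℝ E) :
    ∑ i, ‖T (b i)‖ ^ 2 - finrank ℝ L * K ^ 2 ≤ ∑ i, ‖Lᗮ.starProjection (T (b i))‖ ^ 2 := by
  let f := stdOrthonormalBasis ℝ L
  let P : E →ₗ[ℝ] L := L.orthogonalProjectionOnto.toLinearMap ∘ₗ T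
  have adjoint_P (y : L) : LinearMap.adjoint P y = LinearMap.adjoint T y := by
    refine ext_inner_right ℝ fun x => ?_
    rw [LinearMap.adjoint_inner_left, LinearMap.adjoint_inner_left]
    simp [P]
  have sum_P_le : ∑ i, ‖P (b i)‖ ^ 2 ≤ finrank ℝ L * K ^ 2 := by
    calc ∑ i, ‖P (b i)‖ ^ 2 = ∑ l, ‖LinearMap.adjoint T (f l)‖ ^ 2 := by
          simp_rw [sum_sq_norm_apply_eq_sum_sq_norm_adjoint P b f, adjoint_P]
      _ ≤ ∑ _ : Fin (finrank ℝ L), K ^ 2 := by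
          gcongr with l _
          exact (norm_adjoint_apply_le hK₀ hK (f l)).trans_eq
            (by rw [Submodule.norm_coe, f.norm_eq_one, mul_one])
      _ = finrank ℝ L * K ^ 2 := by simp
  have pythagoras (i) : ‖T (b i)‖ ^ 2 = ‖P (b i)‖ ^ 2 + ‖Lᗮ.starProjection (T (b i))‖ ^ 2 :=
    Submodule.norm_sq_eq_add_norm_sq_starProjection _ L
  simp_rw [pythagoras, Finset.sum_add_distrib]
  linarith

end NearSpan

section FarIndices

variable {m : ℕ}

theorem mul_measureReal_le_card_filter_le {Ω ι : Type*} [MeasurableSpace Ω] (ν : Measure Ω)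
    [IsFiniteMeasure ν] (I : Finset ι) {b : ι → Set Ω} [∀ ω, DecidablePred fun i => ω ∈ b i]
    (hb : ∀ i, MeasurableSet (b i)) {ε : ℝ} (h : ∀ i ∈ I, ν.real (b i) ≤ ε) (n : ℕ) :
    n * ν.real {ω | n ≤ (I.filter fun i => ω ∈ b i).card} ≤ I.card * ε := by
  have card_eq (ω : Ω) : ((I.filter fun i => ω ∈ b i).card : ℝ) =
      ∑ i ∈ I, (b i).indicator (fun _ => 1) ω := by
    simp [Set.indicator_apply, Finset.sum_boole]
  have hInt (i : ι) : Integrable ((b i).indicator fun _ => (1 : ℝ)) ν :=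
    (integrable_const 1).indicator (hb i)
  calc n * ν.real {ω | n ≤ (I.filter fun i => ω ∈ b i).card}
      = n * ν.real {ω | (n : ℝ) ≤ ∑ i ∈ I, (b i).indicator (fun _ => 1) ω} := by
        simp_rw [← card_eq, Nat.cast_le]
    _ ≤ ∫ ω, ∑ i ∈ I, (b i).indicator (fun _ => 1) ω ∂ν :=
        mul_meas_ge_le_integral_of_nonneg
          (ae_of_all _ fun ω => Finset.sum_nonneg fun i _ =>
            Set.indicator_nonneg (fun _ _ => zero_le_one) ω)
          (integrable_finsetSum _ fun i _ => hInt i) _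
    _ = ∑ i ∈ I, ν.real (b i) := by
        rw [integral_finsetSum _ fun i _ => hInt i]
        exact Finset.sum_congr rfl fun i _ => integral_indicator_one (hb i)
    _ ≤ ∑ _ ∈ I, ε := Finset.sum_le_sum h
    _ = I.card * ε := by simp

variable {E F ι : Type*} [NormedAddCommGroup E] [InnerProductSpace ℝ E] [FiniteDimensional ℝ E]
  [MeasurableSpace E] [BorelSpace E] [NormedAddCommGroup F] [InnerProductSpace ℝ F]
  [Fintype ι]

open Classical in
/-- The indices below `N` of the members of a finite sequence that are at distance at least `τ`
from the span of `D` and the members that precede them. -/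
noncomputable def farIndices (D : Submodule ℝ F) (τ : ℝ) (N : ℕ) (x : Fin m → F) :
    Finset (Fin m) :=
  {i | (i : ℕ) < N ∧ ¬NearSpan D τ x i}

variable {T : E →ₗ[ℝ] F} {K h τ : ℝ}

theorem measurableSet_nearSpan_apply (D : Submodule ℝ F) (τ : ℝ) (i : Fin m) :
    MeasurableSet {x : Fin m → E | NearSpan D τ (fun j => T (x j)) i} := by
  have hT : Continuous fun (x : Fin m → E) j => T (x j) :=
    continuous_pi fun j => T.continuous_of_finiteDimensional.comp (continuous_apply j)
  exact ((isOpen_nearSpan D τ i).preimage hT).measurableSet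

variable [FiniteDimensional ℝ F]

theorem stdGaussian_exists_norm_sub_lt_le (hK₀ : 0 ≤ K) (hK : ∀ x, ‖T x‖ ≤ K * ‖x‖)
    (b : OrthonormalBasis ι ℝ E) (L : Submodule ℝ F)
    (hh : h ≤ ∑ i, ‖T (b i)‖ ^ 2 - finrank ℝ L * K ^ 2) (hτ : τ ^ 2 < h) :
    stdGaussian E {x | ∃ z ∈ L, ‖T x - z‖ < τ} ≤
      ENNReal.ofReal (finrank ℝ E * K ^ 4 * chiSqVar / (h - τ ^ 2) ^ 2) := by
  let P : E →ₗ[ℝ] F := Lᗮ.starProjection.toLinearMap ∘ₗ T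
  have hP (x : E) : ‖P x‖ ≤ K * ‖x‖ := (Lᗮ.norm_starProjection_apply_le _).trans (hK x)
  refine (measure_mono ?_).trans (stdGaussian_norm_sq_lt_le P hP b
    (hh.trans (sub_le_sum_norm_sq_starProjection hK₀ hK L b)) hτ)
  rintro x ⟨z, hz, hxz⟩
  have P_eq : P x = Lᗮ.starProjection (T x - z) := by
    rw [map_sub, (Submodule.starProjection_apply_eq_zero_iff _).2
      (L.le_orthogonal_orthogonal hz), sub_zero]
    rfl
  have : ‖P x‖ < τ := P_eq ▸ (Lᗮ.norm_starProjection_apply_le _).trans_lt hxz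
  exact pow_lt_pow_left₀ this (norm_nonneg _) two_ne_zero

theorem pi_stdGaussian_nearSpan_le (hK₀ : 0 ≤ K) (hK : ∀ x, ‖T x‖ ≤ K * ‖x‖)
    (b : OrthonormalBasis ι ℝ E) (D : Submodule ℝ F) (i : Fin m)
    (hh : h ≤ ∑ j, ‖T (b j)‖ ^ 2 - (finrank ℝ D + i : ℕ) * K ^ 2) (hτ : τ ^ 2 < h) :
    (Measure.pi fun _ => stdGaussian E) {x : Fin m → E | NearSpan D τ (fun j => T (x j)) i} ≤
      ENNReal.ofReal (finrank ℝ E * K ^ 4 * chiSqVar / (h - τ ^ 2) ^ 2) := by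
  refine pi_le_of_forall_update_le _ (measurableSet_nearSpan_apply D τ i) i fun x => ?_
  have apply_update (y : E) : (fun j => T (Function.update x i y j)) =
      Function.update (fun j => T (x j)) i (T y) := Function.comp_update _ _ _ _
  simp only [Set.mem_ofPred_eq, NearSpan, apply_update, precedingSpan_update_self,
    Function.update_self]
  refine stdGaussian_exists_norm_sub_lt_le hK₀ hK b _ (hh.trans ?_) hτ
  gcongr
  exact finrank_precedingSpan_le D _ i

theorem pi_stdGaussian_two_mul_card_farIndices_lt_le (hK₀ : 0 ≤ K) (hK : ∀ x, ‖T x‖ ≤ K * ‖x‖)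
    (b : OrthonormalBasis ι ℝ E) (D : Submodule ℝ F) {N : ℕ} (hN : N ≤ m)
    (hh : h ≤ ∑ j, ‖T (b j)‖ ^ 2 - (finrank ℝ D + N : ℕ) * K ^ 2) (hτ : τ ^ 2 < h) :
    (Measure.pi fun _ => stdGaussian E)
      {x : Fin m → E | 2 * (farIndices D τ N fun j => T (x j)).card < N} ≤
        ENNReal.ofReal (2 * (finrank ℝ E * K ^ 4 * chiSqVar / (h - τ ^ 2) ^ 2)) := by
  classical
  set ν := Measure.pi fun _ : Fin m => stdGaussian E
  set ε := finrank ℝ E * K ^ 4 * chiSqVar / (h - τ ^ 2) ^ 2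
  let I : Finset (Fin m) := {i | (i : ℕ) < N}
  let near (i : Fin m) : Set (Fin m → E) := {x | NearSpan D τ (fun j => T (x j)) i}
  have hI : I.card = N := by rw [Fin.card_filter_val_lt, min_eq_right hN]
  have hε : 0 ≤ ε := by have := chiSqVar_nonneg; positivity
  have near_le (i) (hi : i ∈ I) : ν.real (near i) ≤ ε := by
    refine ENNReal.toReal_le_of_le_ofReal hε (pi_stdGaussian_nearSpan_le hK₀ hK b D i
      (hh.trans ?_) hτ)
    have : (i : ℕ) ≤ N := (Finset.mem_filter.1 hi).2.le
    gcongr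
  have subset_many_near : {x : Fin m → E | 2 * (farIndices D τ N fun j => T (x j)).card < N} ⊆
      {x | N / 2 + 1 ≤ (I.filter fun i => x ∈ near i).card} := by
    intro x hx
    have far_eq : farIndices D τ N (fun j => T (x j)) = I.filter fun i => x ∉ near i := by
      rw [Finset.filter_filter, farIndices]
      rfl
    have := Finset.card_filter_add_card_filter_not (s := I) fun i => x ∈ near i
    rw [Set.mem_ofPred_eq, far_eq] at hx
    rw [Set.mem_ofPred_eq]
    lia
  have markov := mul_measureReal_le_card_filter_le ν I (b := near)
    (fun i => measurableSet_nearSpan_apply D τ i) near_le (N / 2 + 1)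
  rw [hI] at markov
  refine (measure_mono subset_many_near).trans ?_
  rw [← ofReal_measureReal]
  refine ENNReal.ofReal_le_ofReal (le_of_mul_le_mul_left (markov.trans ?_)
    (Nat.cast_pos.2 (N / 2).succ_pos))
  rw [← mul_assoc]
  gcongr
  exact_mod_cast (by lia : N ≤ (N / 2 + 1) * 2)

end FarIndices

section GaussianRows

variable {Ω ι κ : Type*} [MeasurableSpace Ω] [Fintype ι] [Fintype κ] {μ : Measure Ω}

theorem map_curry_pi {X : Type*} [MeasurableSpace X] (ν : ι → κ → Measure X)
    [∀ i j, IsProbabilityMeasure (ν i j)] :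
    (Measure.pi fun ij : ι × κ => ν ij.1 ij.2).map (MeasurableEquiv.curry ι κ X) =
      Measure.pi fun i => Measure.pi (ν i) := by
  simpa only [Measure.infinitePi_eq_pi] using Measure.infinitePi_map_curry ν

theorem hasLaw_toLp_pi_stdGaussian [IsProbabilityMeasure μ] {X : ι × κ → Ω → ℝ}
    (hX : ∀ ij, HasLaw (X ij) (gaussianReal 0 1) μ) (hind : iIndepFun X μ) :
    HasLaw (fun ω i => WithLp.toLp 2 fun j => X (i, j) ω)
      (Measure.pi fun _ : ι => stdGaussian (EuclideanSpace ℝ κ)) μ := by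
  have curry_hasLaw : HasLaw (MeasurableEquiv.curry ι κ ℝ)
      (Measure.pi fun _ => Measure.pi fun _ => gaussianReal 0 1)
      (Measure.pi fun _ : ι × κ => gaussianReal 0 1) :=
    ⟨(MeasurableEquiv.measurable _).aemeasurable, map_curry_pi fun _ _ => gaussianReal 0 1⟩
  have toLp_hasLaw : HasLaw (fun (x : ι → κ → ℝ) i => WithLp.toLp 2 (x i))
      (Measure.pi fun _ => stdGaussian (EuclideanSpace ℝ κ))
      (Measure.pi fun _ => Measure.pi fun _ => gaussianReal 0 1) := by
    have toLp_aemeasurable (_ : ι) : AEMeasurable (WithLp.toLp 2 : (κ → ℝ) → EuclideanSpace ℝ κ)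
        (Measure.pi fun _ => gaussianReal 0 1) := (WithLp.measurable_toLp 2 _).aemeasurable
    refine ⟨(measurable_pi_lambda _ fun i => (WithLp.measurable_toLp 2 _).comp
      (measurable_pi_apply i)).aemeasurable, ?_⟩
    rw [← map_pi_eq_stdGaussian, ← Measure.pi_map_pi toLp_aemeasurable]
  exact (toLp_hasLaw.comp curry_hasLaw).comp (hind.hasLaw_pi hX)

theorem hasLaw_toLp_sqrt_smul_row {m k d : ℕ} (hd : d ≠ 0) [IsProbabilityMeasure μ]
    {W : Ω → Matrix (Fin m) (Fin k) ℝ}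
    (hgauss : ∀ i j, HasLaw (fun ω => W ω i j) (gaussianReal 0 (d : ℝ≥0)⁻¹) μ)
    (hiid : iIndepFun (fun (ij : Fin m × Fin k) ω => W ω ij.1 ij.2) μ) :
    HasLaw (fun ω i => WithLp.toLp 2 (√(d : ℝ) • W ω i))
      (Measure.pi fun _ : Fin m => stdGaussian (EuclideanSpace ℝ (Fin k))) μ := by
  refine hasLaw_toLp_pi_stdGaussian (fun ij => ?_)
    (hiid.comp (fun _ x => √(d : ℝ) * x) fun _ => by fun_prop)
  have variance_eq : NNReal.mk (√(d : ℝ) ^ 2) (sq_nonneg _) * (d : ℝ≥0)⁻¹ = 1 := by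
    ext
    simp [hd]
  simpa only [mul_zero, variance_eq, Function.comp_def] using
    gaussianReal_const_mul (hgauss ij.1 ij.2) (√(d : ℝ))

end GaussianRows

section ConditionalProbability

theorem condExp_preimage_prodMk_ae_eq {Ω α β : Type*} [MeasurableSpace Ω] [MeasurableSpace α]
    [StandardBorelSpace α] [Nonempty α] [mβ : MeasurableSpace β] {μ : Measure Ω}
    [IsProbabilityMeasure μ] {X : Ω → α} {Y : Ω → β} (hX : Measurable X) (hY : Measurable Y)
    (hXY : IndepFun X Y μ) {s : Set (β × α)} (hs : MeasurableSet s) :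
    μ⟦{ω | (Y ω, X ω) ∈ s} | mβ.comap Y⟧ =ᵐ[μ]
      fun ω => (μ.map X).real (Prod.mk (Y ω) ⁻¹' s) := by
  have := Measure.isProbabilityMeasure_map (μ := μ) hX.aemeasurable
  have := Measure.isProbabilityMeasure_map (μ := μ) (hY.prodMk hX).aemeasurable
  have condDistrib_eq : condDistrib X Y μ =ᵐ[μ.map Y] Kernel.const β (μ.map X) := by
    refine condDistrib_ae_eq_of_measure_eq_compProd Y hX.aemeasurable ?_
    rw [Measure.compProd_const]
    exact (indepFun_iff_map_prod_eq_prod_map_map hY.aemeasurable hX.aemeasurable).1 hXY.symm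
  have condExp_eq := condExp_prod_ae_eq_integral_condDistrib' (μ := μ) hY hX.aemeasurable
    (f := s.indicator fun _ => (1 : ℝ)) ((integrable_const 1).indicator hs)
  filter_upwards [condExp_eq, ae_of_ae_map hY.aemeasurable condDistrib_eq] with ω hω hdistrib
  refine hω.trans ?_
  rw [hdistrib, Kernel.const_apply]
  exact integral_indicator_one (hs.preimage measurable_prodMk_left)

end ConditionalProbability

section Measurability

variable {m k n a b : ℕ}

local instance : MeasurableSpace (Matrix (Fin a) (Fin b) ℝ) := MeasurableSpace.pi

local instance : BorelSpace (Matrix (Fin a) (Fin b) ℝ) :=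
  inferInstanceAs (BorelSpace (Fin a → Fin b → ℝ))

local instance : SecondCountableTopology (Matrix (Fin a) (Fin b) ℝ) :=
  inferInstanceAs (SecondCountableTopology (Fin a → Fin b → ℝ))

/-- The nuclear norm is a supremum of linear functionals by trace duality, hence lower
semicontinuous. -/
theorem measurable_nuclearNorm : Measurable (nuclearNorm (a := a) (b := b)) := by
  refine measurable_of_Ioi fun s => ?_
  have preimage_eq : nuclearNorm (a := a) (b := b) ⁻¹' Set.Ioi s =
      ⋃ Y ∈ {Y : Matrix (Fin b) (Fin a) ℝ | ‖Y‖ ≤ 1}, {M | s < (M * Y).trace} := by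
    ext M
    simp only [Set.mem_preimage, Set.mem_Ioi, Set.mem_iUnion, Set.mem_ofPred_eq, exists_prop]
    refine ⟨fun hs => ?_, fun ⟨Y, hY, hs⟩ => hs.trans_le ?_⟩
    · obtain ⟨Y, hY, trace_eq⟩ := exists_trace_mul_eq_nuclearNorm M
      exact ⟨Y, hY, trace_eq ▸ hs⟩
    · exact (trace_mul_le_norm_mul_nuclearNorm M Y).trans
        (mul_le_of_le_one_left (nuclearNorm_nonneg M) hY)
  rw [preimage_eq]
  exact (isOpen_biUnion fun Y _ => isOpen_lt continuous_const
    (continuous_id.matrix_mul continuous_const).matrix_trace).measurableSet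

theorem measurable_frobNorm : Measurable (frobNorm (a := a) (b := b)) := by
  refine Continuous.measurable ?_
  unfold frobNorm
  fun_prop

theorem measurable_nuclearRank : Measurable (nuclearRank (a := a) (b := b)) :=
  (measurable_nuclearNorm.pow_const 2).div (measurable_frobNorm.pow_const 2)

theorem measurableSet_largeNuclearRankEvent (d : ℕ) (c ℓ u C₁ C₂ C₃ : ℝ) :
    MeasurableSet (largeNuclearRankEvent d c ℓ u C₁ C₂ C₃
      (fun x : (Matrix (Fin k) (Fin n) ℝ × Matrix (Fin k) (Fin n) ℝ) × Matrix (Fin m) (Fin k) ℝ =>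
        x.1.1) (fun x => x.1.2) fun x => x.2) := by
  simp only [largeNuclearRankEvent, matrixGradient_gdIterate, Set.ofPred_forall]
  refine .iInter fun t => .iInter fun _ => .iInter fun _ => measurableSet_le measurable_const
    (measurable_nuclearRank.comp ?_)
  have gram_continuous : Continuous (gram (k := k) (n := n)) := by
    unfold gram
    fun_prop
  have opNorm_continuous : Continuous (opNorm (a := k)) :=
    continuous_norm (E := Matrix (Fin k) (Fin k) ℝ)
  have step_measurable : Measurable fun x : (Matrix (Fin k) (Fin n) ℝ × Matrix (Fin k) (Fin n) ℝ) ×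
      Matrix (Fin m) (Fin k) ℝ => 1 / (c * opNorm (gram x.1.1)) :=
    measurable_const.div (measurable_const.mul (opNorm_continuous.comp
      (gram_continuous.comp (continuous_fst.comp continuous_fst))).measurable)
  have gradient_continuous : Continuous fun z : ((Matrix (Fin k) (Fin n) ℝ ×
      Matrix (Fin k) (Fin n) ℝ) × Matrix (Fin m) (Fin k) ℝ) × ℝ =>
      -(z.1.2 * (crossGram z.1.1.1 z.1.1.2 * (1 - z.2 • gram z.1.1.1) ^ t)) := by
    unfold crossGram
    fun_prop
  exact gradient_continuous.measurable.comp (measurable_id.prodMk step_measurable)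

theorem condExp_largeNuclearRankEvent_ae_eq {Ω : Type*} [MeasurableSpace Ω] {μ : Measure Ω}
    [IsProbabilityMeasure μ] (d : ℕ) (c ℓ u C₁ C₂ C₃ : ℝ)
    {A Abar : Ω → Matrix (Fin k) (Fin n) ℝ} {Wbar : Ω → Matrix (Fin m) (Fin k) ℝ}
    (hA : ∀ i j, Measurable fun ω => A ω i j) (hAbar : ∀ i j, Measurable fun ω => Abar ω i j)
    (hWbar : ∀ i j, Measurable fun ω => Wbar ω i j)
    (hindep : IndepFun (fun ω i j => Wbar ω i j)
      (fun ω => (fun i j => A ω i j, fun i j => Abar ω i j)) μ) :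
    μ⟦largeNuclearRankEvent d c ℓ u C₁ C₂ C₃ A Abar Wbar | sigmaPair A Abar⟧ =ᵐ[μ] fun ω =>
      μ.real (largeNuclearRankEvent d c ℓ u C₁ C₂ C₃ (fun _ => A ω) (fun _ => Abar ω) Wbar) := by
  have measurable_entries {a b : ℕ} {M : Ω → Matrix (Fin a) (Fin b) ℝ}
      (hM : ∀ i j, Measurable fun ω => M ω i j) : Measurable fun ω i j => M ω i j :=
    measurable_pi_lambda _ fun i => measurable_pi_lambda _ (hM i)
  have hs := measurableSet_largeNuclearRankEvent (m := m) (k := k) (n := n) d c ℓ u C₁ C₂ C₃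
  refine (condExp_preimage_prodMk_ae_eq (measurable_entries hWbar)
    ((measurable_entries hA).prodMk (measurable_entries hAbar)) hindep hs).trans
      (ae_of_all _ fun ω => ?_)
  exact map_measureReal_apply (measurable_entries hWbar) (hs.preimage measurable_prodMk_left)

end Measurability

section FilteredTeacher

variable {m k p N : ℕ} {D : Submodule ℝ (EuclideanSpace ℝ (Fin k))}
  {V : Matrix (Fin k) (Fin p) ℝ} {S M : Matrix (Fin k) (Fin k) ℝ} {κ σ ρ τ x y : ℝ}

theorem IsFilteredBulk.card_mul_le_nuclearNorm (hM : IsFilteredBulk D V S κ σ ρ M) (hτ : 0 < τ)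
    (G : Matrix (Fin m) (Fin k) ℝ) {J : Finset (Fin m)}
    (hJ : ∀ i ∈ J, ¬NearSpan D τ (fun i => toEuclideanLin Sᵀ (WithLp.toLp 2 (G i))) i) :
    J.card * τ ≤ ρ * nuclearNorm (G * M) := by
  obtain ⟨q, q_mem, q_orthonormal, hq⟩ := exists_orthonormal_of_not_nearSpan D hτ _ J hJ
  obtain ⟨R, hR, hMR⟩ := hM.exists_mul_apply_eq
  let e := EuclideanSpace.basisFun (Fin m) ℝ
  have inner_eq (i : J) : inner ℝ (e i) (toEuclideanLin (G * M * R) (q i)) =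
      inner ℝ (toEuclideanLin Sᵀ (WithLp.toLp 2 (G i))) (q i) := by
    rw [Matrix.mul_assoc, toEuclideanLin_mul_apply, hMR _ (q_mem i), ← toEuclideanLin_mul_apply,
      ← toLp_row_mul]
    simp [e, Matrix.toLpLin_apply, Matrix.mulVec, dotProduct, PiLp.inner_apply, mul_comm]
  calc J.card * τ = ∑ _ : J, τ := by simp
    _ ≤ ∑ i : J, inner ℝ (e i) (toEuclideanLin (G * M * R) (q i)) :=
        Finset.sum_le_sum fun i _ => inner_eq i ▸ hq i
    _ ≤ ‖R‖ * nuclearNorm (G * M) :=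
        sum_inner_le_norm_mul_nuclearNorm _ R q_orthonormal
          (e.orthonormal.comp _ Subtype.val_injective) _
    _ ≤ ρ * nuclearNorm (G * M) := by gcongr; exact nuclearNorm_nonneg _

/-- The deterministic properties of a random `G` with standard Gaussian rows that make the nuclear
rank of `G * M` large for every `M` with `IsFilteredBulk D V S κ σ ρ M`. -/
structure IsTypical (D : Submodule ℝ (EuclideanSpace ℝ (Fin k))) (V : Matrix (Fin k) (Fin p) ℝ)
    (S : Matrix (Fin k) (Fin k) ℝ) (τ : ℝ) (N : ℕ) (x y : ℝ) (G : Matrix (Fin m) (Fin k) ℝ) :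
    Prop where
  frobNorm_mul_sq_le : frobNorm (G * V) ^ 2 ≤ x
  frobNorm_sq_le : frobNorm G ^ 2 ≤ y
  le_card : N ≤
    2 * (farIndices D τ N fun i => toEuclideanLin Sᵀ (WithLp.toLp 2 (G i))).card

theorem IsTypical.le_nuclearRank_mul {G : Matrix (Fin m) (Fin k) ℝ}
    (hG : IsTypical D V S τ N x y G) (hM : IsFilteredBulk D V S κ σ ρ M) (hτ : 0 < τ) (hρ : 0 < ρ)
    (hN : 0 < N) :
    (N * τ / (2 * ρ)) ^ 2 / (2 * (κ ^ 2 * x) + 2 * (σ ^ 2 * y)) ≤ nuclearRank (G * M) := by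
  refine div_le_nuclearRank (by positivity) ?_ ?_
  · have le_nuclearNorm := hM.card_mul_le_nuclearNorm hτ G
      (J := farIndices D τ N fun i => toEuclideanLin Sᵀ (WithLp.toLp 2 (G i)))
      fun i hi => (by simpa only [farIndices, Finset.mem_filter_univ] using hi : _ ∧ _).2
    have le_card : (N : ℝ) ≤
        2 * (farIndices D τ N fun i => toEuclideanLin Sᵀ (WithLp.toLp 2 (G i))).card := by
      exact_mod_cast hG.le_card
    rw [div_le_iff₀ (by positivity)]
    nlinarith
  · refine (hM.frobNorm_mul_sq_le G).trans ?_
    gcongr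
    exacts [hG.frobNorm_mul_sq_le, hG.frobNorm_sq_le]

theorem pi_stdGaussian_not_isTypical_le {K h s : ℝ} (hV : Vᵀ * V = 1) (hS : ‖S‖ ≤ K) (hN : N ≤ m)
    (hh : h ≤ frobNorm S ^ 2 - (finrank ℝ D + N : ℕ) * K ^ 2) (hτ : τ ^ 2 < h) (hx : 0 < x)
    (hs : 0 < s) :
    (Measure.pi fun _ : Fin m => stdGaussian (EuclideanSpace ℝ (Fin k))).real
        {g | ¬IsTypical D V S τ N x (m * k + s) (Matrix.of fun i => (g i).ofLp)} ≤
      m * p / x + m * (k * chiSqVar) / s ^ 2 + 2 * (k * K ^ 4 * chiSqVar / (h - τ ^ 2) ^ 2) := by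
  let b := EuclideanSpace.basisFun (Fin k) ℝ
  set ν := Measure.pi fun _ : Fin m => stdGaussian (EuclideanSpace ℝ (Fin k))
  have chiSqVar_nonneg := chiSqVar_nonneg
  have head_le : ν.real {g | x ≤ ∑ i, ‖toEuclideanLin Vᵀ (g i)‖ ^ 2} ≤ m * p / x := by
    refine ENNReal.toReal_le_of_le_ofReal (by positivity) ?_
    simpa only [← frobNorm_sq_eq_sum_norm_basis, frobNorm_transpose,
      frobNorm_sq_of_transpose_mul_self_eq_one hV]
      using pi_stdGaussian_le_sum_norm_sq_le (m := m) (toEuclideanLin Vᵀ) b hx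
  have total_le : ν.real {g | m * k + s ≤ ∑ i, ‖g i‖ ^ 2} ≤ m * (k * chiSqVar) / s ^ 2 := by
    refine ENNReal.toReal_le_of_le_ofReal (by positivity) ?_
    simpa using pi_stdGaussian_add_le_sum_norm_sq_le (m := m) (K := 1)
      (LinearMap.id : EuclideanSpace ℝ (Fin k) →ₗ[ℝ] _) (by simp) b hs
  have far_le : ν.real {g | 2 * (farIndices D τ N fun i => toEuclideanLin Sᵀ (g i)).card < N} ≤
      2 * (k * K ^ 4 * chiSqVar / (h - τ ^ 2) ^ 2) := by
    refine ENNReal.toReal_le_of_le_ofReal (by positivity) ?_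
    refine (pi_stdGaussian_two_mul_card_farIndices_lt_le ((norm_nonneg S).trans hS)
      (fun g => (norm_toEuclideanLin_apply_le _ _).trans ?_) b D hN ?_ hτ).trans_eq
        (by rw [finrank_euclideanSpace_fin])
    · rw [norm_transpose]
      gcongr
    · rwa [← frobNorm_sq_eq_sum_norm_basis, frobNorm_transpose]
  refine (measureReal_mono fun g hg => ?_).trans
    ((measureReal_union_le _ _).trans (add_le_add ((measureReal_union_le _ _).trans
      (add_le_add head_le total_le)) far_le))
  contrapose! hg
  simp only [Set.mem_union, Set.mem_ofPred_eq, not_or, not_le, not_lt] at hg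
  obtain ⟨⟨hhead, htotal⟩, hfar⟩ := hg
  refine not_not.2 ⟨?_, ?_, hfar⟩
  · rw [frobNorm_sq_eq_sum_norm_row]
    simp_rw [toLp_row_mul]
    exact hhead.le
  · rw [frobNorm_sq_eq_sum_norm_row]
    exact htotal.le

end FilteredTeacher

section FixedDimension

variable {c₁ c₂ ℓ u b β θ ρ : ℝ} {d m k n p r N : ℕ}

/-- The inequalities between the dimensions that the estimates at a fixed `d` require. The constant
`b` bounds the number of rows and columns of the teacher per unit of `d`, the first `N ≥ θ d` rows
are those used for the nuclear norm, and `β` measures the part of the bulk that is left after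
`2 p + N` dimensions have been projected out. -/
structure IsAdmissible (c₁ c₂ ℓ u b β θ : ℝ) (d m k p r N : ℕ) : Prop where
  one_le : 1 ≤ d
  lt_spike : c₂ < c₁ * (d : ℝ) ^ ℓ
  le_top_spike : 2 * c₂ ≤ c₁ * (d : ℝ) ^ u
  rows_le : m ≤ b * d
  cols_le : k ≤ b * d
  le_rows : N ≤ m
  mul_le : θ * d ≤ N
  two_mul_le : 2 * (β * d) ≤ r * c₁ ^ 2 - (2 * p + N) * c₂ ^ 2

/-- The constant `C₂` of the theorem, where `ρ` is the bound on the inverse of the bulk filter. -/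
noncomputable def rankConst (c₁ c₂ b β θ ρ : ℝ) : ℝ :=
  β * θ ^ 2 / (8 * ρ ^ 2 * ((3 * c₂ ^ 2 / c₁) ^ 2 + c₂ ^ 2 * (b ^ 2 + 1)))

theorem rankConst_pos (hc₁ : 0 < c₁) (hc₂ : 0 < c₂) (hβ : 0 < β) (hθ : 0 < θ) (hρ : 0 < ρ) :
    0 < rankConst c₁ c₂ b β θ ρ := by
  unfold rankConst
  positivity

/-- A bound for the probability that the teacher is not typical. -/
noncomputable def failureBound (c₂ ℓ u b β : ℝ) (d p : ℕ) : ℝ :=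
  b * (p / (d : ℝ) ^ (1 - 2 * (u - ℓ))) + b ^ 2 * chiSqVar / (d : ℝ) ^ 2 +
    2 * b * c₂ ^ 4 * chiSqVar / β ^ 2 / d

theorem IsAdmissible.rankConst_mul_le (h : IsAdmissible c₁ c₂ ℓ u b β θ d m k p r N)
    (hc₁ : 0 < c₁) (hc₂ : 0 < c₂) (hβ : 0 < β) (hθ : 0 < θ) (hρ : 0 < ρ) :
    rankConst c₁ c₂ b β θ ρ * d ≤ (N * √(β * d) / (2 * ρ)) ^ 2 /
      (2 * ((3 * c₂ ^ 2 / c₁ * (d : ℝ) ^ (u - ℓ)) ^ 2 * (d / (d : ℝ) ^ (u - ℓ)) ^ 2) +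
        2 * (c₂ ^ 2 * (m * k + (d : ℝ) ^ 2))) := by
  have d_pos : (0 : ℝ) < d := by exact_mod_cast h.one_le
  have := Real.rpow_pos_of_pos d_pos (u - ℓ)
  calc rankConst c₁ c₂ b β θ ρ * d
      = (θ * d * √(β * d) / (2 * ρ)) ^ 2 /
        (2 * ((3 * c₂ ^ 2 / c₁ * (d : ℝ) ^ (u - ℓ)) ^ 2 * (d / (d : ℝ) ^ (u - ℓ)) ^ 2) +
          2 * (c₂ ^ 2 * (b * d * (b * d) + (d : ℝ) ^ 2))) := by
        rw [div_pow (_ * √_), mul_pow (_ * _) √_, Real.sq_sqrt (by positivity), rankConst]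
        field_simp
        ring
    _ ≤ _ := by
        have := h.rows_le
        have := h.cols_le
        have := h.mul_le
        gcongr
        exact (Nat.cast_nonneg m).trans h.rows_le

theorem IsAdmissible.failure_le (h : IsAdmissible c₁ c₂ ℓ u b β θ d m k p r N) (hβ : 0 < β) :
    m * p / (d / (d : ℝ) ^ (u - ℓ)) ^ 2 + m * (k * chiSqVar) / ((d : ℝ) ^ 2) ^ 2 +
      2 * (k * c₂ ^ 4 * chiSqVar / (2 * (β * d) - √(β * d) ^ 2) ^ 2) ≤
    failureBound c₂ ℓ u b β d p := by
  have chiSqVar_nonneg := chiSqVar_nonneg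
  have d_pos : (0 : ℝ) < d := by exact_mod_cast h.one_le
  have := Real.rpow_pos_of_pos d_pos (u - ℓ)
  have rpow_eq : (d : ℝ) ^ (1 - 2 * (u - ℓ)) = d / ((d : ℝ) ^ (u - ℓ)) ^ 2 := by
    rw [Real.rpow_sub d_pos, Real.rpow_one, mul_comm, Real.rpow_mul d_pos.le, Real.rpow_two]
  rw [Real.sq_sqrt (by positivity), failureBound, rpow_eq]
  calc m * p / (d / (d : ℝ) ^ (u - ℓ)) ^ 2 + m * (k * chiSqVar) / ((d : ℝ) ^ 2) ^ 2 +
        2 * (k * c₂ ^ 4 * chiSqVar / (2 * (β * d) - β * d) ^ 2)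
      ≤ b * d * p / (d / (d : ℝ) ^ (u - ℓ)) ^ 2 +
        b * d * (b * d * chiSqVar) / ((d : ℝ) ^ 2) ^ 2 +
        2 * (b * d * c₂ ^ 4 * chiSqVar / (2 * (β * d) - β * d) ^ 2) := by
        have := h.rows_le
        have := h.cols_le
        gcongr
        exact (Nat.cast_nonneg m).trans h.rows_le
    _ = _ := by
        rw [two_mul (β * d), add_sub_cancel_right]
        field_simp

theorem IsAdmissible.bulkRank_pos (h : IsAdmissible c₁ c₂ ℓ u b β θ d m k p r N) (hβ : 0 < β) :
    0 < r := by
  have d_pos : (0 : ℝ) < d := by exact_mod_cast h.one_le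
  refine Nat.pos_of_ne_zero ?_
  rintro rfl
  have : 0 < 2 * (β * d) + (2 * p + N) * c₂ ^ 2 := by positivity
  have := h.two_mul_le
  rw [Nat.cast_zero, zero_mul, zero_sub] at this
  linarith

variable {Ω : Type*} [MeasurableSpace Ω] {μ : Measure Ω} [IsProbabilityMeasure μ]
  {W : Ω → Matrix (Fin m) (Fin k) ℝ}

theorem IsAdmissible.measureReal_not_isTypical_le {D : Submodule ℝ (EuclideanSpace ℝ (Fin k))}
    {V : Matrix (Fin k) (Fin p) ℝ} {S : Matrix (Fin k) (Fin k) ℝ}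
    (h : IsAdmissible c₁ c₂ ℓ u b β θ d m k p r N) (hβ : 0 < β) (hD : finrank ℝ D ≤ 2 * p)
    (hV : Vᵀ * V = 1) (hS : ‖S‖ ≤ c₂) (hr : r * c₁ ^ 2 ≤ frobNorm S ^ 2)
    (hgauss : ∀ i j, HasLaw (fun ω => W ω i j) (gaussianReal 0 (d : ℝ≥0)⁻¹) μ)
    (hiid : iIndepFun (fun (ij : Fin m × Fin k) ω => W ω ij.1 ij.2) μ) :
    μ.real {ω | ¬IsTypical D V S √(β * d) N ((d / (d : ℝ) ^ (u - ℓ)) ^ 2) (m * k + (d : ℝ) ^ 2)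
      (√(d : ℝ) • W ω)} ≤ failureBound c₂ ℓ u b β d p := by
  have d_pos : (0 : ℝ) < d := by exact_mod_cast h.one_le
  have := Real.rpow_pos_of_pos d_pos (u - ℓ)
  have law := hasLaw_toLp_sqrt_smul_row (Nat.one_le_iff_ne_zero.1 h.one_le) hgauss hiid
  have le_map := Measure.le_map_apply law.aemeasurable {g | ¬IsTypical D V S √(β * d) N
    ((d / (d : ℝ) ^ (u - ℓ)) ^ 2) (m * k + (d : ℝ) ^ 2) (Matrix.of fun i => (g i).ofLp)}
  refine (ENNReal.toReal_mono (measure_ne_top _ _) le_map).trans ?_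
  rw [law.map_eq]
  refine (pi_stdGaussian_not_isTypical_le hV hS h.le_rows (h.two_mul_le.trans ?_) ?_ (by positivity)
    (by positivity)).trans (h.failure_le hβ)
  · push_cast
    gcongr
    exact_mod_cast hD
  · rw [Real.sq_sqrt (by positivity)]
    linarith [mul_pos hβ d_pos]

theorem one_sub_measureReal_not_le {P : Ω → Prop} {s : Set Ω} (h : ∀ ω, P ω → ω ∈ s) :
    1 - μ.real {ω | ¬P ω} ≤ μ.real s := by
  have univ_subset : Set.univ ⊆ s ∪ {ω | ¬P ω} := fun ω _ => (em (P ω)).imp (h ω) id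
  have := (measureReal_mono (μ := μ) univ_subset).trans (measureReal_union_le _ _)
  rwa [probReal_univ, ← sub_le_iff_le_add] at this

theorem IsAdmissible.one_sub_failureBound_le {c C₃ : ℝ} {A Abar : Matrix (Fin k) (Fin n) ℝ}
    (h : IsAdmissible c₁ c₂ ℓ u b β θ d m k p r N)
    (hc₁ : 0 < c₁) (hc₂ : 0 < c₂) (hu₀ : 0 ≤ u) (hu : u ≤ 1) (hc : 1 ≤ c) (hβ : 0 < β)
    (hθ : 0 < θ) (hmodel : MultiSpiked d p r c₁ c₂ ℓ u A Abar)
    (hgauss : ∀ i j, HasLaw (fun ω => W ω i j) (gaussianReal 0 (d : ℝ≥0)⁻¹) μ)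
    (hiid : iIndepFun (fun (ij : Fin m × Fin k) ω => W ω ij.1 ij.2) μ) :
    1 - failureBound c₂ ℓ u b β d p ≤ μ.real (largeNuclearRankEvent d c ℓ u (2 * c * c₂ / c₁)
      (rankConst c₁ c₂ b β θ (Real.exp (2 * C₃ * c₂ / (c * c₁)))) C₃
      (fun _ => A) (fun _ => Abar) W) := by
  obtain ⟨D, V, S, hD, hV, hS, hr, filtered⟩ := hmodel.exists_isFilteredBulk (C₃ := C₃)
    hc₁ hc₂ hu₀ hu hc h.one_le (h.bulkRank_pos hβ) h.lt_spike h.le_top_spike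
  have atypical_le := h.measureReal_not_isTypical_le hβ hD hV hS hr hgauss hiid
  have d_pos : (0 : ℝ) < d := by exact_mod_cast h.one_le
  have N_pos : 0 < N := by exact_mod_cast (mul_pos hθ d_pos).trans_le h.mul_le
  refine (sub_le_sub_left atypical_le 1).trans
    (one_sub_measureReal_not_le fun ω typical t ht htu => ?_)
  rw [matrixGradient_gdIterate, ← nuclearRank_smul (neg_ne_zero.2 (Real.sqrt_pos.2 d_pos).ne'),
    neg_smul_neg, ← Matrix.smul_mul]
  exact (h.rankConst_mul_le hc₁ hc₂ hβ hθ (Real.exp_pos _)).trans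
    (typical.le_nuclearRank_mul (filtered t ht htu) (by positivity) (Real.exp_pos _) N_pos)

end FixedDimension

section Asymptotics

variable {m k p r : ℕ → ℕ} {c₁ c₂ ℓ u b : ℝ}

theorem exists_pos_eventually_natCast_le_mul {f g : ℕ → ℕ}
    (h : (fun d => (f d : ℝ)) =O[atTop] fun d => (g d : ℝ)) :
    ∃ b > 0, ∀ᶠ d in atTop, (f d : ℝ) ≤ b * g d := by
  obtain ⟨b, hb, hfg⟩ := h.exists_pos
  exact ⟨b, hb, by simpa only [Real.norm_natCast] using hfg.bound⟩

theorem eventually_lt_mul_rpow (C : ℝ) {a s : ℝ} (ha : 0 < a) (hs : 0 < s) :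
    ∀ᶠ d : ℕ in atTop, C < a * (d : ℝ) ^ s :=
  (((tendsto_rpow_atTop hs).comp tendsto_natCast_atTop_atTop).const_mul_atTop
    ha).eventually_gt_atTop C

theorem eventually_natCast_le_mul_of_isLittleO {ε s : ℝ} (hε : 0 < ε) (hs : 0 ≤ s)
    (hp : (fun d => (p d : ℝ)) =o[atTop] fun d => (d : ℝ) ^ (1 - s)) :
    ∀ᶠ d in atTop, (p d : ℝ) ≤ ε * d := by
  filter_upwards [hp.bound hε, eventually_ge_atTop 1] with d hpd hd
  have hd₁ : (1 : ℝ) ≤ d := by exact_mod_cast hd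
  rw [Real.norm_natCast, Real.norm_of_nonneg (by positivity)] at hpd
  exact hpd.trans (mul_le_mul_of_nonneg_left
    ((Real.rpow_le_rpow_of_exponent_le hd₁ (sub_le_self 1 hs)).trans_eq (Real.rpow_one _)) hε.le)

theorem tendsto_failureBound
    (hp : (fun d => (p d : ℝ)) =o[atTop] fun d => (d : ℝ) ^ (1 - 2 * (u - ℓ))) (β : ℝ) :
    Tendsto (fun d => failureBound c₂ ℓ u b β d (p d)) atTop (𝓝 0) := by
  have natCast_tendsto := tendsto_natCast_atTop_atTop (R := ℝ)
  have head := hp.tendsto_div_nhds_zero.const_mul b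
  have total : Tendsto (fun d : ℕ => b ^ 2 * chiSqVar / (d : ℝ) ^ 2) atTop (𝓝 0) :=
    tendsto_const_nhds.div_atTop ((tendsto_pow_atTop two_ne_zero).comp natCast_tendsto)
  have far : Tendsto (fun d : ℕ => 2 * b * c₂ ^ 4 * chiSqVar / β ^ 2 / d) atTop (𝓝 0) :=
    tendsto_const_nhds.div_atTop natCast_tendsto
  simpa only [failureBound, mul_zero, add_zero] using (head.add total).add far

theorem isAdmissible_ceil {β θ : ℝ} {d m k p r : ℕ} (hd : 1 ≤ d)
    (hsep : c₂ < c₁ * (d : ℝ) ^ ℓ) (hstep : 2 * c₂ ≤ c₁ * (d : ℝ) ^ u) (hm : m ≤ b * d)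
    (hk : k ≤ b * d) (hθd : 1 ≤ θ * d) (hθm : 2 * θ * d ≤ m) (hθβ : 2 * θ * c₂ ^ 2 ≤ β)
    (hp : 2 * c₂ ^ 2 * p ≤ β * d) (hr : 4 * β * d ≤ r * c₁ ^ 2) :
    IsAdmissible c₁ c₂ ℓ u b β θ d m k p r ⌈θ * d⌉₊ := by
  have ceil_le : (⌈θ * d⌉₊ : ℝ) ≤ 2 * θ * d := by
    linarith [Nat.ceil_lt_add_one (zero_le_one.trans hθd)]
  refine ⟨hd, hsep, hstep, hm, hk, by exact_mod_cast ceil_le.trans hθm, Nat.le_ceil _, ?_⟩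
  have rows_le : ⌈θ * d⌉₊ * c₂ ^ 2 ≤ β * d := by
    calc ⌈θ * d⌉₊ * c₂ ^ 2 ≤ 2 * θ * d * c₂ ^ 2 := by gcongr
      _ = 2 * θ * c₂ ^ 2 * d := by ring
      _ ≤ β * d := by gcongr
  linarith

theorem exists_eventually_isAdmissible (hc₁ : 0 < c₁) (hc₂ : 0 < c₂) (hℓ : 0 < ℓ) (hℓu : ℓ ≤ u)
    (hk : (fun d => (k d : ℝ)) =O[atTop] fun d => (d : ℝ))
    (hm : (fun d => (m d : ℝ)) =Θ[atTop] fun d => (d : ℝ))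
    (hr : (fun d : ℕ => (d : ℝ)) =O[atTop] fun d => (r d : ℝ))
    (hp : (fun d => (p d : ℝ)) =o[atTop] fun d => (d : ℝ) ^ (1 - 2 * (u - ℓ))) :
    ∃ b, ∃ β > 0, ∃ θ > 0, ∀ᶠ d in atTop,
      ∃ N, IsAdmissible c₁ c₂ ℓ u b β θ d (m d) (k d) (p d) (r d) N := by
  obtain ⟨bm, -, m_le⟩ := exists_pos_eventually_natCast_le_mul (f := m) (g := fun d => d) hm.1
  obtain ⟨bk, -, k_le⟩ := exists_pos_eventually_natCast_le_mul (f := k) (g := fun d => d) hk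
  obtain ⟨am, ham, le_m⟩ := exists_pos_eventually_natCast_le_mul (f := fun d => d) (g := m) hm.2
  obtain ⟨ar, har, le_r⟩ := exists_pos_eventually_natCast_le_mul (f := fun d => d) (g := r) hr
  let β := c₁ ^ 2 / (4 * ar)
  let θ := min am⁻¹ (β / c₂ ^ 2) / 2
  have hβ : 0 < β := by positivity
  have hθ : 0 < θ := half_pos (lt_min (by positivity) (by positivity))
  have two_mul_θ : 2 * θ = min am⁻¹ (β / c₂ ^ 2) := mul_div_cancel₀ _ two_ne_zero
  refine ⟨max bm bk, β, hβ, θ, hθ, ?_⟩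
  filter_upwards [eventually_ge_atTop 1, m_le, k_le, le_m, le_r,
    eventually_natCast_le_mul_of_isLittleO (ε := β / (2 * c₂ ^ 2)) (by positivity)
      (mul_nonneg zero_le_two (sub_nonneg.2 hℓu)) hp,
    eventually_lt_mul_rpow c₂ hc₁ hℓ, eventually_lt_mul_rpow (2 * c₂) hc₁ (hℓ.trans_le hℓu),
    tendsto_natCast_atTop_atTop.eventually_ge_atTop θ⁻¹]
    with d hd hmd hkd hdm hdr hpd hsep hstep hθd
  refine ⟨⌈θ * d⌉₊, isAdmissible_ceil hd hsep hstep.le (hmd.trans ?_) (hkd.trans ?_)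
    ((inv_le_iff_one_le_mul₀' hθ).1 hθd) ?_ ?_ ?_ ?_⟩
  · gcongr
    exact le_max_left _ _
  · gcongr
    exact le_max_right _ _
  · calc 2 * θ * d ≤ am⁻¹ * d := by rw [two_mul_θ]; gcongr; exact min_le_left _ _
      _ ≤ m d := (inv_mul_le_iff₀ ham).2 hdm
  · rw [two_mul_θ, ← le_div_iff₀ (by positivity)]
    exact min_le_right _ _
  · rwa [← le_div_iff₀' (by positivity), mul_div_right_comm]
  · calc 4 * β * d = c₁ ^ 2 / ar * d := by simp only [β]; field_simp
      _ ≤ c₁ ^ 2 / ar * (ar * r d) := by gcongr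
      _ = r d * c₁ ^ 2 := by field_simp

end Asymptotics

end MultiSpike

theorem mainTheorem6_general
    (m k n p r : ℕ → ℕ) (c₁ c₂ ℓ u c : ℝ)
    (hc₁ : 0 < c₁) (hc₁₂ : c₁ ≤ c₂)
    (hℓ : 0 < ℓ) (hℓu : ℓ ≤ u) (hu : u ≤ 1) (hc : 1 ≤ c)
    (hk : (fun d : ℕ => (k d : ℝ)) =O[atTop] (fun d : ℕ => (d : ℝ)))
    (hm : (fun d : ℕ => (m d : ℝ)) =Θ[atTop] (fun d : ℕ => (d : ℝ)))
    (hr : (fun d : ℕ => (d : ℝ)) =O[atTop] (fun d : ℕ => (r d : ℝ)))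
    (hp : (fun d : ℕ => (p d : ℝ)) =o[atTop] (fun d : ℕ => (d : ℝ) ^ (1 - 2 * (u - ℓ))))
    (Ω : ℕ → Type*) [∀ d, MeasurableSpace (Ω d)]
    (μ : ∀ d, Measure (Ω d)) [∀ d, IsProbabilityMeasure (μ d)]
    (A Abar : ∀ d, Ω d → Matrix (Fin (k d)) (Fin (n d)) ℝ)
    (Wbar : ∀ d, Ω d → Matrix (Fin (m d)) (Fin (k d)) ℝ)
    (hA : ∀ d i j, Measurable fun ω => A d ω i j)
    (hAbar : ∀ d i j, Measurable fun ω => Abar d ω i j)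
    (hWbar : ∀ d i j, Measurable fun ω => Wbar d ω i j)
    (hgauss : ∀ d i j, HasLaw (fun ω => Wbar d ω i j) (gaussianReal 0 (d : ℝ≥0)⁻¹) (μ d))
    (hiid : ∀ d, iIndepFun (fun (ij : Fin (m d) × Fin (k d)) ω => Wbar d ω ij.1 ij.2) (μ d))
    (hindep : ∀ d, IndepFun (fun ω i j => Wbar d ω i j)
      (fun ω => (fun i j => A d ω i j, fun i j => Abar d ω i j)) (μ d)) :
    ∃ C₁ > 0, ∀ C₃ > 0, ∃ C₂ > 0, ∀ δ > 0, ∀ᶠ d in atTop,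
      ∀ᵐ ω ∂(μ d), MultiSpike.MultiSpiked d (p d) (r d) c₁ c₂ ℓ u (A d ω) (Abar d ω) →
        1 - δ ≤ ((μ d)⟦MultiSpike.largeNuclearRankEvent d c ℓ u C₁ C₂ C₃
          (A d) (Abar d) (Wbar d) | MultiSpike.sigmaPair (A d) (Abar d)⟧) ω := by
  have hc₂ : 0 < c₂ := hc₁.trans_le hc₁₂
  obtain ⟨b, β, hβ, θ, hθ, admissible⟩ :=
    MultiSpike.exists_eventually_isAdmissible hc₁ hc₂ hℓ hℓu hk hm hr hp
  have failure_tendsto := MultiSpike.tendsto_failureBound (c₂ := c₂) (b := b) hp β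
  refine ⟨2 * c * c₂ / c₁, by positivity, fun C₃ _ =>
    ⟨MultiSpike.rankConst c₁ c₂ b β θ (Real.exp (2 * C₃ * c₂ / (c * c₁))),
      MultiSpike.rankConst_pos hc₁ hc₂ hβ hθ (Real.exp_pos _), fun δ hδ => ?_⟩⟩
  filter_upwards [admissible, failure_tendsto.eventually_le_const hδ] with d ⟨N, hN⟩ failure_le
  filter_upwards [MultiSpike.condExp_largeNuclearRankEvent_ae_eq d c ℓ u _ _ C₃
    (hA d) (hAbar d) (hWbar d) (hindep d)] with ω condExp_eq hmodel
  rw [condExp_eq]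
  exact (sub_le_sub_left failure_le 1).trans <|
    hN.one_sub_failureBound_le hc₁ hc₂ (hℓ.trans_le hℓu).le hu hc hβ hθ hmodel (hgauss d) (hiid d)

theorem mainTheorem6
    (m k n p r : ℕ → ℕ) (c₁ c₂ ℓ u γ c : ℝ)
    (hc₁ : 0 < c₁) (hc₁₂ : c₁ ≤ c₂)
    (hℓ : 0 < ℓ) (hℓu : ℓ ≤ u) (hu : u ≤ 1) (hgap : u - ℓ < 1 / 2)
    (hγ : 0 < γ) (hc : 1 ≤ c)
    (hk : Tendsto (fun d : ℕ => (k d : ℝ) / d) atTop (𝓝 γ))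
    (hm : (fun d : ℕ => (m d : ℝ)) =Θ[atTop] (fun d : ℕ => (d : ℝ)))
    (hr : (fun d : ℕ => (r d : ℝ)) =Θ[atTop] (fun d : ℕ => (d : ℝ)))
    (hp : (fun d : ℕ => (p d : ℝ)) =o[atTop] (fun d : ℕ => (d : ℝ) ^ (1 - 2 * (u - ℓ))))
    (Ω : ℕ → Type*) [∀ d, MeasurableSpace (Ω d)]
    (μ : ∀ d, Measure (Ω d)) [∀ d, IsProbabilityMeasure (μ d)]
    (A Abar : ∀ d, Ω d → Matrix (Fin (k d)) (Fin (n d)) ℝ)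
    (Wbar : ∀ d, Ω d → Matrix (Fin (m d)) (Fin (k d)) ℝ)
    (hA : ∀ d i j, Measurable fun ω => A d ω i j)
    (hAbar : ∀ d i j, Measurable fun ω => Abar d ω i j)
    (hWbar : ∀ d i j, Measurable fun ω => Wbar d ω i j)
    (hgauss : ∀ d i j, HasLaw (fun ω => Wbar d ω i j) (gaussianReal 0 (d : ℝ≥0)⁻¹) (μ d))
    (hiid : ∀ d, iIndepFun (fun (ij : Fin (m d) × Fin (k d)) ω => Wbar d ω ij.1 ij.2) (μ d))
    (hindep : ∀ d, IndepFun (fun ω i j => Wbar d ω i j)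
      (fun ω => (fun i j => A d ω i j, fun i j => Abar d ω i j)) (μ d)) :
    ∃ C₁ > 0, ∀ C₃ > 0, ∃ C₂ > 0, ∀ δ > 0, ∀ᶠ d in atTop,
      ∀ᵐ ω ∂(μ d), MultiSpike.MultiSpiked d (p d) (r d) c₁ c₂ ℓ u (A d ω) (Abar d ω) →
        1 - δ ≤ ((μ d)⟦MultiSpike.largeNuclearRankEvent d c ℓ u C₁ C₂ C₃
          (A d) (Abar d) (Wbar d) | MultiSpike.sigmaPair (A d) (Abar d)⟧) ω := by
  have k_isBigO : (fun d : ℕ => (k d : ℝ)) =O[atTop] fun d : ℕ => (d : ℝ) :=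
    isBigO_of_div_tendsto_nhds ((eventually_ne_atTop 0).mono fun d hd hd' =>
      (hd (Nat.cast_eq_zero.1 hd')).elim) γ hk
  exact mainTheorem6_general m k n p r c₁ c₂ ℓ u c hc₁ hc₁₂ hℓ hℓu hu hc k_isBigO hm hr.2 hp Ω μ
    A Abar Wbar hA hAbar hWbar hgauss hiid hindep
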